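/- Let $(M,g)$ be a compact Kähler surface, that is, a compact complex manifold $M$ of complex dimension $2$, with complex structure $J$, together with a smooth Riemannian metric $g$ such that $g(JX,JY)=g(X,Y)$ and such that the form $\omega(X,Y)=g(JX,Y)$ is closed. Suppose that $g$ is Ricci-flat. For $p\in M$ let $H_{\max}(p)$ (respectively $H_{\min}(p)$) denote the maximum (respectively the minimum) of the holomorphic sectional curvatures at $p$, that is, of the sectional curvatures $K(u,Ju)$ over all non-zero $u\in T_pM$. If there is a constant $c$ with $0\le c<\frac{1+\sqrt3}{2}$ such that $$H_{\max}(p)\ \le\ -c\,H_{\min}(p)\qquad\text{for all } p\in M,$$ then $(M,g)$ is flat, that is, its Riemann curvature tensor vanishes identically. -/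

import Mathlib

open Manifold
open scoped ContDiff Bundle

noncomputable section

/-! ### Riemannian geometry in a chart

A Riemannian metric on an open subset of a finite-dimensional real vector space `E` is a function
`G` with values in the bilinear forms on `E`; all notions below depend only on the germ of `G` at
the point `y`. -/

section Local

variable {E : Type*} [NormedAddCommGroup E] [NormedSpace ℝ E]

/-- Twice the Christoffel symbols of the first kind, as a linear form in `w`:
`w ↦ (D_u G)(v, w) + (D_v G)(u, w) - (D_w G)(u, v)`. -/
def christoffelForm (G : E → E →L[ℝ] E →L[ℝ] ℝ) (y u v : E) : E →L[ℝ] ℝ :=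
  fderiv ℝ G y u v + fderiv ℝ G y v u - ((fderiv ℝ G y).flip u).flip v

theorem christoffelForm_apply (G : E → E →L[ℝ] E →L[ℝ] ℝ) (y u v w : E) :
    christoffelForm G y u v w =
      fderiv ℝ G y u v w + fderiv ℝ G y v u w - fderiv ℝ G y w u v := rfl

/-- The Christoffel symbols of the Levi-Civita connection of `G`: `Γ(u, v)` is the vector with
`G(Γ(u, v), w) = ½ ((D_u G)(v, w) + (D_v G)(u, w) - (D_w G)(u, v))` for all `w`. -/
def christoffel (G : E → E →L[ℝ] E →L[ℝ] ℝ) (y u v : E) : E :=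
  (G y).inverse ((1 / 2 : ℝ) • christoffelForm G y u v)

/-- The Riemann curvature `R(u, v) w = ∇_u ∇_v w - ∇_v ∇_u w`, for constant vector fields
`u`, `v`, `w`. -/
def curvature (G : E → E →L[ℝ] E →L[ℝ] ℝ) (y u v w : E) : E :=
  fderiv ℝ (fun x => christoffel G x v w) y u - fderiv ℝ (fun x => christoffel G x u w) y v
    + christoffel G y u (christoffel G y v w) - christoffel G y v (christoffel G y u w)

/-- The Ricci curvature `Ric(v, w) = tr (u ↦ R(u, v) w)`, the trace being computed in some
basis of `E`. -/
def ricci [FiniteDimensional ℝ E] (G : E → E →L[ℝ] E →L[ℝ] ℝ) (y v w : E) : ℝ :=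
  ∑ i, (Module.finBasis ℝ E).coord i (curvature G y (Module.finBasis ℝ E i) v w)

/-- The sectional curvature of the plane spanned by `u` and `v`. -/
def sectional (G : E → E →L[ℝ] E →L[ℝ] ℝ) (y u v : E) : ℝ :=
  G y (curvature G y u v v) u / (G y u u * G y v v - G y u v ^ 2)

end Local

/-! ### Metrics on a complex manifold -/

section Global

variable {E : Type*} [NormedAddCommGroup E] [NormedSpace ℂ E]

/-- Multiplication by `i`, as a real linear map. -/
def mulI : E →L[ℝ] E := Complex.I • ContinuousLinearMap.id ℝ E

/-- The real manifold underlying a complex manifold. -/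
instance isManifold_real_of_complex {M : Type*} [TopologicalSpace M] [ChartedSpace E M]
    [IsManifold 𝓘(ℂ, E) ω M] : IsManifold 𝓘(ℝ, E) ω M := by
  refine isManifold_of_contDiffOn 𝓘(ℝ, E) ω M fun e e' he he' => ?_
  have h := HasGroupoid.compatible (G := contDiffGroupoid ω 𝓘(ℂ, E)) he he'
  rw [contDiffGroupoid, mem_groupoid_of_pregroupoid] at h
  exact ContDiffOn.restrict_scalars ℝ h.1

variable {M : Type*} [TopologicalSpace M] [ChartedSpace E M] [IsManifold 𝓘(ℂ, E) ω M]

variable (E M) in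
/-- Smooth Riemannian metrics on the real manifold underlying a complex manifold. -/
abbrev SmoothMetric : Type _ :=
  Bundle.ContMDiffRiemannianMetric 𝓘(ℝ, E) ∞ E (fun p : M => TangentSpace 𝓘(ℝ, E) p)

/-- The metric `g` read in the chart `e`, that is, the pullback of `g` by `e.symm`. -/
def localMetric (g : SmoothMetric E M) (e : OpenPartialHomeomorph M E) (y : E) :
    E →L[ℝ] E →L[ℝ] ℝ :=
  let b : E →L[ℝ] E →L[ℝ] ℝ := g.inner (e.symm y)
  let d : E →L[ℝ] E := mfderiv 𝓘(ℝ, E) 𝓘(ℝ, E) e.symm y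
  b.bilinearComp d d

theorem localMetric_apply (g : SmoothMetric E M) (e : OpenPartialHomeomorph M E) (y u v : E) :
    localMetric g e y u v = g.inner (e.symm y) (mfderiv 𝓘(ℝ, E) 𝓘(ℝ, E) e.symm y u)
      (mfderiv 𝓘(ℝ, E) 𝓘(ℝ, E) e.symm y v) := rfl

/-- `g` is Kähler: it is invariant under the complex structure `J`, which is multiplication by `i`
in the holomorphic charts, and the Kähler form `ω(u, v) = g(J u, v)` is closed, that is,
`dω(u, v, w) = (D_u ω)(v, w) - (D_v ω)(u, w) + (D_w ω)(u, v)` vanishes. -/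
structure IsKahler (g : SmoothMetric E M) : Prop where
  hermitian : ∀ e ∈ atlas E M, ∀ y ∈ e.target, ∀ u v : E,
    localMetric g e y (mulI u) (mulI v) = localMetric g e y u v
  closed : ∀ e ∈ atlas E M, ∀ y ∈ e.target, ∀ u v w : E,
    fderiv ℝ (localMetric g e) y u (mulI v) w - fderiv ℝ (localMetric g e) y v (mulI u) w
      + fderiv ℝ (localMetric g e) y w (mulI u) v = 0

/-- The curvature tensor at `p`. Tangent vectors at `p` are read in the preferred holomorphic
chart at `p`, as in the definition of `TangentSpace`. -/
def curvatureAt (g : SmoothMetric E M) (p : M) (u v w : E) : E :=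
  curvature (localMetric g (chartAt E p)) (chartAt E p p) u v w

/-- The Ricci tensor at `p`. -/
def ricciAt [FiniteDimensional ℂ E] (g : SmoothMetric E M) (p : M) (v w : E) : ℝ :=
  ricci (localMetric g (chartAt E p)) (chartAt E p p) v w

/-- The holomorphic sectional curvature at `p` of the complex line spanned by `u`, that is, the
sectional curvature of the real plane spanned by `u` and `J u`. -/
def holSectionalAt (g : SmoothMetric E M) (p : M) (u : E) : ℝ :=
  sectional (localMetric g (chartAt E p)) (chartAt E p p) u (mulI u)

/-- The maximum of the holomorphic sectional curvatures at `p`. -/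
def Hmax (g : SmoothMetric E M) (p : M) : ℝ :=
  sSup {h | ∃ u : E, u ≠ 0 ∧ holSectionalAt g p u = h}

/-- The minimum of the holomorphic sectional curvatures at `p`. -/
def Hmin (g : SmoothMetric E M) (p : M) : ℝ :=
  sInf {h | ∃ u : E, u ≠ 0 ∧ holSectionalAt g p u = h}

/-- The Ricci tensor vanishes identically. -/
def IsRicciFlat [FiniteDimensional ℂ E] (g : SmoothMetric E M) : Prop :=
  ∀ (p : M) (v w : E), ricciAt g p v w = 0

/-- The Riemann curvature tensor vanishes identically. -/
def IsFlat (g : SmoothMetric E M) : Prop := ∀ (p : M) (u v w : E), curvatureAt g p u v w = 0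

end Global

end

/-!
A Ricci-flat Kähler surface whose holomorphic sectional curvature is nonnegative is flat: the
curvature is determined by the holomorphic sectional curvature, and it is trace-free in a unitary
frame. It therefore suffices to show that the minimum `m` of the holomorphic sectional curvature
is nonnegative.

Let `m` be attained at a point `q` by a unit vector, and extend this vector to a unitary frame of
constant fields `e` in holomorphic coordinates that are normal at `q`. The function
`G(R(e₀, i e₀) i e₀, e₀) - m G(e₀, e₀)²` is nonnegative and vanishes at `q`, so its Laplacian there
is nonnegative. On the other hand Ricci-flatness makes this Laplacian a multiple of a quadratic
expression in the curvature, and that expression has the opposite sign if `m < 0` and the curvature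
is pinched. The Laplacian is computed with the two families of commuting Wirtinger derivations
acting on the components of the metric, a computation in a commutative algebra.
-/

open scoped Topology

set_option maxSynthPendingDepth 3

noncomputable section

section Calculus

variable {E F : Type*} [NormedAddCommGroup E] [NormedSpace ℝ E] [NormedAddCommGroup F]
  [NormedSpace ℝ F]

theorem contDiffOn_fderiv_of_isOpen {f : E → F} {U : Set E} (hU : IsOpen U)
    (hf : ContDiffOn ℝ ∞ f U) : ContDiffOn ℝ ∞ (fderiv ℝ f) U :=
  hf.fderiv_of_isOpen hU (by simp)

theorem differentiableAt_of_contDiffOn {f : E → F} {U : Set E} (hU : IsOpen U)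
    (hf : ContDiffOn ℝ ∞ f U) {x : E} (hx : x ∈ U) : DifferentiableAt ℝ f x :=
  (hf.contDiffAt (hU.mem_nhds hx)).differentiableAt (by simp)

theorem fderiv_fderiv_comm {f : E → F} {U : Set E} (hU : IsOpen U) (hf : ContDiffOn ℝ ∞ f U)
    {x : E} (hx : x ∈ U) (u v : E) :
    fderiv ℝ (fderiv ℝ f) x u v = fderiv ℝ (fderiv ℝ f) x v u :=
  ((hf.contDiffAt (hU.mem_nhds hx)).isSymmSndFDerivAt
    (by simpa using WithTop.coe_le_coe.2 (le_top : (2 : ℕ∞) ≤ ⊤))).eq u v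

theorem fderiv_eq_of_eqOn {f g : E → F} {U : Set E} (hU : IsOpen U) (h : Set.EqOn f g U) {x : E}
    (hx : x ∈ U) : fderiv ℝ f x = fderiv ℝ g x :=
  (h.eventuallyEq_of_mem (hU.mem_nhds hx)).fderiv_eq

variable {E₁ E₂ : Type*} [NormedAddCommGroup E₁] [NormedSpace ℝ E₁] [NormedAddCommGroup E₂]
  [NormedSpace ℝ E₂]

theorem fderiv_apply_const {B : E → E₁ →L[ℝ] F} {x : E} (hB : DifferentiableAt ℝ B x) (a : E)
    (b : E₁) : fderiv ℝ (fun t => B t b) x a = fderiv ℝ B x a b := by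
  rw [fderiv_clm_apply hB (differentiableAt_const b)]
  simp

theorem fderiv_apply_const₂ {B : E → E₁ →L[ℝ] E₂ →L[ℝ] F} {x : E} (hB : DifferentiableAt ℝ B x)
    (a : E) (b : E₁) (c : E₂) : fderiv ℝ (fun t => B t b c) x a = fderiv ℝ B x a b c := by
  rw [fderiv_apply_const (B := fun t => B t b) (by fun_prop), fderiv_apply_const hB]

theorem fderiv_apply₂ {B : E → E₁ →L[ℝ] E₂ →L[ℝ] F} {y : E → E₁} {z : E → E₂} {x : E}
    (hB : DifferentiableAt ℝ B x) (hy : DifferentiableAt ℝ y x) (hz : DifferentiableAt ℝ z x)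
    (a : E) :
    fderiv ℝ (fun t => B t (y t) (z t)) x a =
      fderiv ℝ B x a (y x) (z x) + B x (fderiv ℝ y x a) (z x) + B x (y x) (fderiv ℝ z x a) := by
  rw [fderiv_clm_apply (c := fun t => B t (y t)) (by fun_prop) hz, add_apply,
    ContinuousLinearMap.flip_apply, fderiv_clm_apply hB hy]
  simp only [ContinuousLinearMap.comp_apply, add_apply, ContinuousLinearMap.flip_apply]
  abel

end Calculus

/-! ### Levi-Civita connection and curvature -/

section Riemann

variable {E : Type*} [NormedAddCommGroup E] [NormedSpace ℝ E]

/-- `G` is a smooth Riemannian metric on the open set `U`. -/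
structure IsMetricOn (G : E → E →L[ℝ] E →L[ℝ] ℝ) (U : Set E) : Prop where
  isOpen : IsOpen U
  smooth : ContDiffOn ℝ ∞ G U
  symm : ∀ x ∈ U, ∀ u v, G x u v = G x v u
  pos : ∀ x ∈ U, ∀ u, u ≠ 0 → 0 < G x u u

/-- The Christoffel symbols of `G` as a function with values in the continuous bilinear maps, in
which form they can be differentiated. -/
def christoffelCLM (G : E → E →L[ℝ] E →L[ℝ] ℝ) (y : E) : E →L[ℝ] E →L[ℝ] E :=
  (1 / 2 : ℝ) • (ContinuousLinearMap.compL ℝ E (E →L[ℝ] ℝ) E (G y).inverse).comp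
    (fderiv ℝ G y + (fderiv ℝ G y).flip -
      ((ContinuousLinearMap.flipₗᵢ ℝ E E ℝ).toContinuousLinearEquiv :
        (E →L[ℝ] E →L[ℝ] ℝ) →L[ℝ] (E →L[ℝ] E →L[ℝ] ℝ)).comp (fderiv ℝ G y).flip)

theorem christoffelCLM_apply (G : E → E →L[ℝ] E →L[ℝ] ℝ) (y u v : E) :
    christoffelCLM G y u v = christoffel G y u v := by
  rw [christoffel, map_smul]
  rfl

variable {G : E → E →L[ℝ] E →L[ℝ] ℝ} {U : Set E}

namespace IsMetricOn

theorem differentiableAt (h : IsMetricOn G U) {x : E} (hx : x ∈ U) : DifferentiableAt ℝ G x :=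
  differentiableAt_of_contDiffOn h.isOpen h.smooth hx

theorem ext_apply (h : IsMetricOn G U) {x : E} (hx : x ∈ U) {a b : E}
    (hab : ∀ w, G x a w = G x b w) : a = b := by
  by_contra hne
  have hpos := h.pos x hx (a - b) (sub_ne_zero.2 hne)
  rw [map_sub (G x), sub_apply, hab, sub_self] at hpos
  exact lt_irrefl _ hpos

theorem fderiv_symm (h : IsMetricOn G U) {x : E} (hx : x ∈ U) (a u v : E) :
    fderiv ℝ G x a u v = fderiv ℝ G x a v u := by
  have hsymm : Set.EqOn (fun y => G y u v) (fun y => G y v u) U := fun y hy => h.symm y hy u v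
  have hd := h.differentiableAt hx
  rw [← fderiv_apply_const₂ hd, ← fderiv_apply_const₂ hd, fderiv_eq_of_eqOn h.isOpen hsymm hx]

variable [FiniteDimensional ℝ E]

theorem isInvertible (h : IsMetricOn G U) {x : E} (hx : x ∈ U) : (G x).IsInvertible := by
  have hinj : Function.Injective (G x : E →ₗ[ℝ] (E →L[ℝ] ℝ)) := fun a b hab =>
    h.ext_apply hx fun w => congrArg (fun l : E →L[ℝ] ℝ => l w) hab
  have hfr : Module.finrank ℝ E = Module.finrank ℝ (E →L[ℝ] ℝ) := by
    rw [← LinearEquiv.finrank_eq (LinearMap.toContinuousLinearMap (𝕜 := ℝ) (E := E) (F' := ℝ))]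
    exact (Subspace.dual_finrank_eq (K := ℝ) (V := E)).symm
  exact ⟨(LinearEquiv.ofInjectiveOfFinrankEq _ hinj hfr).toContinuousLinearEquiv, rfl⟩

theorem apply_christoffel (h : IsMetricOn G U) {x : E} (hx : x ∈ U) (u v w : E) :
    G x (christoffel G x u v) w =
      (fderiv ℝ G x u v w + fderiv ℝ G x v u w - fderiv ℝ G x w u v) / 2 := by
  obtain ⟨e, he⟩ := h.isInvertible hx
  have hinv : G x (christoffel G x u v) = (1 / 2 : ℝ) • christoffelForm G x u v := by
    rw [christoffel, ← he, ContinuousLinearMap.inverse_equiv]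
    exact e.apply_symm_apply _
  rw [hinv, smul_apply, christoffelForm_apply, smul_eq_mul]
  ring

theorem christoffel_eq (h : IsMetricOn G U) {x : E} (hx : x ∈ U) {u v z : E}
    (hz : ∀ w, G x z w = (fderiv ℝ G x u v w + fderiv ℝ G x v u w - fderiv ℝ G x w u v) / 2) :
    christoffel G x u v = z :=
  h.ext_apply hx fun w => by rw [h.apply_christoffel hx, hz]

theorem christoffelCLM_symm (h : IsMetricOn G U) {x : E} (hx : x ∈ U) (u v : E) :
    christoffelCLM G x u v = christoffelCLM G x v u := by
  rw [christoffelCLM_apply, christoffelCLM_apply]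
  refine h.christoffel_eq hx fun w => ?_
  rw [h.apply_christoffel hx, h.fderiv_symm hx w]
  ring

theorem fderiv_eq (h : IsMetricOn G U) {x : E} (hx : x ∈ U) (a v w : E) :
    fderiv ℝ G x a v w = G x (christoffelCLM G x a v) w + G x v (christoffelCLM G x a w) := by
  rw [christoffelCLM_apply, christoffelCLM_apply, h.symm x hx v, h.apply_christoffel hx,
    h.apply_christoffel hx, h.fderiv_symm hx a w v]
  ring

theorem contDiffOn_christoffelCLM (h : IsMetricOn G U) :
    ContDiffOn ℝ ∞ (christoffelCLM G) U := by
  have hG' := contDiffOn_fderiv_of_isOpen h.isOpen h.smooth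
  have hflip : ContDiffOn ℝ ∞ (fun y => (fderiv ℝ G y).flip) U :=
    (ContinuousLinearMap.flipₗᵢ ℝ E E (E →L[ℝ] ℝ)).toContinuousLinearEquiv.contDiff.comp_contDiffOn
      hG'
  have hinv : ContDiffOn ℝ ∞ (fun y => (G y).inverse) U := fun y hy =>
    ((h.isInvertible hy).contDiffAt_map_inverse.comp y
      (h.smooth.contDiffAt (h.isOpen.mem_nhds hy))).contDiffWithinAt
  have hcompL := (ContinuousLinearMap.compL ℝ E (E →L[ℝ] ℝ) E).contDiff.comp_contDiffOn hinv
  exact (contDiffOn_const (c := (1 / 2 : ℝ))).smul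
    (hcompL.clm_comp ((hG'.add hflip).sub (contDiffOn_const.clm_comp hflip)))

theorem differentiableAt_christoffelCLM (h : IsMetricOn G U) {x : E} (hx : x ∈ U) :
    DifferentiableAt ℝ (christoffelCLM G) x :=
  differentiableAt_of_contDiffOn h.isOpen h.contDiffOn_christoffelCLM hx

theorem fderiv_christoffelCLM_symm (h : IsMetricOn G U) {x : E} (hx : x ∈ U) (a u v : E) :
    fderiv ℝ (christoffelCLM G) x a u v = fderiv ℝ (christoffelCLM G) x a v u := by
  have hd := h.differentiableAt_christoffelCLM hx
  rw [← fderiv_apply_const₂ hd, ← fderiv_apply_const₂ hd,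
    fderiv_eq_of_eqOn h.isOpen (fun y hy => h.christoffelCLM_symm hy u v) hx]

theorem curvature_eq (h : IsMetricOn G U) {x : E} (hx : x ∈ U) (u v w : E) :
    curvature G x u v w = fderiv ℝ (christoffelCLM G) x u v w - fderiv ℝ (christoffelCLM G) x v u w
      + christoffelCLM G x u (christoffelCLM G x v w)
      - christoffelCLM G x v (christoffelCLM G x u w) := by
  have hd := h.differentiableAt_christoffelCLM hx
  simp only [curvature, ← christoffelCLM_apply]
  rw [fderiv_apply_const₂ hd, fderiv_apply_const₂ hd]

theorem curvature_self (h : IsMetricOn G U) {x : E} (hx : x ∈ U) (u w : E) :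
    curvature G x u u w = 0 := by
  rw [h.curvature_eq hx, sub_self, zero_add, sub_self]

theorem fderiv_fderiv_apply (h : IsMetricOn G U) {x : E} (hx : x ∈ U) (a b v w : E) :
    fderiv ℝ (fderiv ℝ G) x a b v w =
      G x (fderiv ℝ (christoffelCLM G) x a b v + christoffelCLM G x a (christoffelCLM G x b v)) w
      + G x v (fderiv ℝ (christoffelCLM G) x a b w + christoffelCLM G x a (christoffelCLM G x b w))
      + G x (christoffelCLM G x b v) (christoffelCLM G x a w)
      + G x (christoffelCLM G x a v) (christoffelCLM G x b w) := by
  have hG := h.differentiableAt hx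
  have hG' : DifferentiableAt ℝ (fderiv ℝ G) x :=
    differentiableAt_of_contDiffOn h.isOpen (contDiffOn_fderiv_of_isOpen h.isOpen h.smooth) hx
  have hΓ := h.differentiableAt_christoffelCLM hx
  have hderiv := DFunLike.congr_fun
    (fderiv_eq_of_eqOn h.isOpen (fun y hy => h.fderiv_eq hy b v w) hx) a
  rw [fderiv_apply_const₂ (B := fun y => fderiv ℝ G y b) (by fun_prop), fderiv_apply_const hG',
    fderiv_fun_add (by fun_prop) (by fun_prop), add_apply,
    fderiv_apply₂ (z := fun _ => w) hG (by fun_prop) (by fun_prop),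
    fderiv_apply₂ (y := fun _ => v) hG (by fun_prop) (by fun_prop),
    fderiv_apply_const₂ hΓ, fderiv_apply_const₂ hΓ, h.fderiv_eq hx, h.fderiv_eq hx] at hderiv
  simp only [hderiv, map_add, add_apply, fderiv_fun_const, Pi.zero_apply, zero_apply, map_zero]
  ring

theorem curvature_skew (h : IsMetricOn G U) {x : E} (hx : x ∈ U) (a b v w : E) :
    G x (curvature G x a b v) w + G x v (curvature G x a b w) = 0 := by
  have hcomm := congrArg (fun l : E →L[ℝ] E →L[ℝ] ℝ => l v w)
    (fderiv_fderiv_comm h.isOpen h.smooth hx a b)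
  simp only [h.fderiv_fderiv_apply hx] at hcomm
  rw [h.curvature_eq hx, h.curvature_eq hx]
  simp only [map_add, map_sub, add_apply, sub_apply] at hcomm ⊢
  linarith

end IsMetricOn

/-! ### Naturality of the curvature -/

/-- `φ` is a smooth immersion of the open set `V` into `U`. Since source and target have the same
dimension, it is a local diffeomorphism, along which metrics and their curvature are pulled back. -/
structure IsImmersionOn (φ : E → E) (V U : Set E) : Prop where
  isOpen : IsOpen V
  smooth : ContDiffOn ℝ ∞ φ V
  mapsTo : Set.MapsTo φ V U
  injective : ∀ x ∈ V, Function.Injective (fderiv ℝ φ x)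

/-- The pullback of the metric `G` by `φ`. -/
def pullbackMetric (φ : E → E) (G : E → E →L[ℝ] E →L[ℝ] ℝ) (x : E) : E →L[ℝ] E →L[ℝ] ℝ :=
  (G (φ x)).bilinearComp (fderiv ℝ φ x) (fderiv ℝ φ x)

theorem pullbackMetric_apply (φ : E → E) (G : E → E →L[ℝ] E →L[ℝ] ℝ) (x u v : E) :
    pullbackMetric φ G x u v = G (φ x) (fderiv ℝ φ x u) (fderiv ℝ φ x v) := rfl

namespace IsImmersionOn

variable {φ : E → E} {V : Set E}

theorem contDiffOn_fderiv (hφ : IsImmersionOn φ V U) : ContDiffOn ℝ ∞ (fderiv ℝ φ) V :=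
  contDiffOn_fderiv_of_isOpen hφ.isOpen hφ.smooth

theorem differentiableAt (hφ : IsImmersionOn φ V U) {x : E} (hx : x ∈ V) :
    DifferentiableAt ℝ φ x :=
  differentiableAt_of_contDiffOn hφ.isOpen hφ.smooth hx

theorem differentiableAt_fderiv (hφ : IsImmersionOn φ V U) {x : E} (hx : x ∈ V) :
    DifferentiableAt ℝ (fderiv ℝ φ) x :=
  differentiableAt_of_contDiffOn hφ.isOpen hφ.contDiffOn_fderiv hx

theorem surjective [FiniteDimensional ℝ E] (hφ : IsImmersionOn φ V U) {x : E} (hx : x ∈ V) :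
    Function.Surjective (fderiv ℝ φ x) :=
  LinearMap.surjective_of_injective (f := (fderiv ℝ φ x : E →ₗ[ℝ] E)) (hφ.injective x hx)

end IsImmersionOn

namespace IsMetricOn

variable {φ : E → E} {V : Set E} [FiniteDimensional ℝ E]

theorem pullback (h : IsMetricOn G U) (hφ : IsImmersionOn φ V U) :
    IsMetricOn (pullbackMetric φ G) V where
  isOpen := hφ.isOpen
  smooth := by
    have hGφ : ContDiffOn ℝ ∞ (fun x => G (φ x)) V := h.smooth.comp hφ.smooth hφ.mapsTo
    have hφ' (u : E) : ContDiffOn ℝ ∞ (fun x => fderiv ℝ φ x u) V :=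
      hφ.contDiffOn_fderiv.clm_apply contDiffOn_const
    exact contDiffOn_clm_apply.2 fun u => contDiffOn_clm_apply.2 fun v =>
      (hGφ.clm_apply (hφ' u)).clm_apply (hφ' v)
  symm x hx u v := h.symm _ (hφ.mapsTo hx) _ _
  pos x hx u hu := h.pos _ (hφ.mapsTo hx) _ fun h0 =>
    hu (hφ.injective x hx (h0.trans (map_zero _).symm))

theorem fderiv_pullback (h : IsMetricOn G U) (hφ : IsImmersionOn φ V U) {x : E} (hx : x ∈ V)
    (a v w : E) :
    fderiv ℝ (pullbackMetric φ G) x a v w =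
      fderiv ℝ G (φ x) (fderiv ℝ φ x a) (fderiv ℝ φ x v) (fderiv ℝ φ x w)
      + G (φ x) (fderiv ℝ (fderiv ℝ φ) x a v) (fderiv ℝ φ x w)
      + G (φ x) (fderiv ℝ φ x v) (fderiv ℝ (fderiv ℝ φ) x a w) := by
  have hφ' := hφ.differentiableAt_fderiv hx
  have hG := h.differentiableAt (hφ.mapsTo hx)
  have hGφ : DifferentiableAt ℝ (fun y => G (φ y)) x := hG.comp x (hφ.differentiableAt hx)
  have hchain : fderiv ℝ (fun y => G (φ y)) x a = fderiv ℝ G (φ x) (fderiv ℝ φ x a) :=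
    DFunLike.congr_fun (fderiv_comp x hG (hφ.differentiableAt hx)) a
  rw [← fderiv_apply_const₂ ((h.pullback hφ).differentiableAt hx)]
  simp only [pullbackMetric_apply]
  rw [fderiv_apply₂ hGφ (by fun_prop) (by fun_prop), hchain, fderiv_apply_const hφ',
    fderiv_apply_const hφ']

theorem fderiv_christoffel_pullback (h : IsMetricOn G U) (hφ : IsImmersionOn φ V U) {x : E}
    (hx : x ∈ V) (u v : E) :
    fderiv ℝ φ x (christoffelCLM (pullbackMetric φ G) x u v) =
      christoffelCLM G (φ x) (fderiv ℝ φ x u) (fderiv ℝ φ x v) + fderiv ℝ (fderiv ℝ φ) x u v := by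
  have hφx := hφ.mapsTo hx
  have hcomm := fderiv_fderiv_comm hφ.isOpen hφ.smooth hx
  obtain ⟨z, hz⟩ := hφ.surjective hx
    (christoffelCLM G (φ x) (fderiv ℝ φ x u) (fderiv ℝ φ x v) + fderiv ℝ (fderiv ℝ φ) x u v)
  rw [christoffelCLM_apply, (h.pullback hφ).christoffel_eq hx (z := z), hz]
  intro w
  rw [pullbackMetric_apply, hz, christoffelCLM_apply, map_add, add_apply, h.apply_christoffel hφx,
    h.fderiv_pullback hφ hx, h.fderiv_pullback hφ hx, h.fderiv_pullback hφ hx, hcomm v u,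
    hcomm w u, hcomm w v, h.symm _ hφx (fderiv ℝ φ x v), h.symm _ hφx (fderiv ℝ φ x u)]
  ring

theorem fderiv_fderiv_christoffel_pullback (h : IsMetricOn G U) (hφ : IsImmersionOn φ V U)
    {x : E} (hx : x ∈ V) (a b c : E) :
    fderiv ℝ φ x (fderiv ℝ (christoffelCLM (pullbackMetric φ G)) x a b c)
      + fderiv ℝ (fderiv ℝ φ) x a (christoffelCLM (pullbackMetric φ G) x b c) =
      fderiv ℝ (christoffelCLM G) (φ x) (fderiv ℝ φ x a) (fderiv ℝ φ x b) (fderiv ℝ φ x c)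
      + christoffelCLM G (φ x) (fderiv ℝ (fderiv ℝ φ) x a b) (fderiv ℝ φ x c)
      + christoffelCLM G (φ x) (fderiv ℝ φ x b) (fderiv ℝ (fderiv ℝ φ) x a c)
      + fderiv ℝ (fderiv ℝ (fderiv ℝ φ)) x a b c := by
  have hφ' := hφ.differentiableAt_fderiv hx
  have hφ'' : DifferentiableAt ℝ (fderiv ℝ (fderiv ℝ φ)) x := differentiableAt_of_contDiffOn
    hφ.isOpen (contDiffOn_fderiv_of_isOpen hφ.isOpen hφ.contDiffOn_fderiv) hx
  have hΓ := h.differentiableAt_christoffelCLM (hφ.mapsTo hx)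
  have hΓφ : DifferentiableAt ℝ (fun y => christoffelCLM G (φ y)) x :=
    hΓ.comp x (hφ.differentiableAt hx)
  have hΓ' := (h.pullback hφ).differentiableAt_christoffelCLM hx
  have hchain : fderiv ℝ (fun y => christoffelCLM G (φ y)) x a =
      fderiv ℝ (christoffelCLM G) (φ x) (fderiv ℝ φ x a) :=
    DFunLike.congr_fun (fderiv_comp x hΓ (hφ.differentiableAt hx)) a
  have hderiv := DFunLike.congr_fun (fderiv_eq_of_eqOn hφ.isOpen
    (fun y hy => h.fderiv_christoffel_pullback hφ hy b c) hx) a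
  rwa [fderiv_clm_apply hφ' (by fun_prop), fderiv_fun_add (by fun_prop) (by fun_prop),
    add_apply, add_apply, fderiv_apply₂ hΓφ (by fun_prop) (by fun_prop), hchain,
    fderiv_apply_const hφ', fderiv_apply_const hφ', fderiv_apply_const₂ hφ'',
    ContinuousLinearMap.comp_apply, ContinuousLinearMap.flip_apply,
    fderiv_apply_const₂ hΓ'] at hderiv

theorem fderiv_curvature_pullback (h : IsMetricOn G U) (hφ : IsImmersionOn φ V U) {x : E}
    (hx : x ∈ V) (u v w : E) :
    fderiv ℝ φ x (curvature (pullbackMetric φ G) x u v w) =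
      curvature G (φ x) (fderiv ℝ φ x u) (fderiv ℝ φ x v) (fderiv ℝ φ x w) := by
  have hsnd := fderiv_fderiv_comm hφ.isOpen hφ.smooth hx u v
  have hthird := congrArg (fun l : E →L[ℝ] E => l w)
    (fderiv_fderiv_comm hφ.isOpen hφ.contDiffOn_fderiv hx u v)
  have huv := h.fderiv_fderiv_christoffel_pullback hφ hx u v w
  have hvu := h.fderiv_fderiv_christoffel_pullback hφ hx v u w
  rw [hthird, hsnd, ← eq_sub_iff_add_eq] at huv
  rw [← eq_sub_iff_add_eq] at hvu
  rw [(h.pullback hφ).curvature_eq hx, h.curvature_eq (hφ.mapsTo hx)]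
  simp only [map_add, map_sub, h.fderiv_christoffel_pullback hφ hx, huv, hvu]
  abel

end IsMetricOn

end Riemann

/-! ### Kähler metrics -/

section ComplexLinear

open Complex

variable {V W : Type*} [AddCommGroup V] [Module ℂ V] [AddCommGroup W] [Module ℂ W]

theorem I_smul_I_smul (a : V) : I • I • a = -a := by
  rw [smul_smul, I_mul_I, neg_one_smul]

theorem smul_eq_re_add_im (c : ℂ) (u : V) : c • u = c.re • u + c.im • (I • u) := by
  conv_lhs => rw [← re_add_im c]
  rw [add_smul, mul_smul]
  rfl

theorem map_smul_of_map_I_smul {L : V →ₗ[ℝ] W} (hL : ∀ u, L (I • u) = I • L u) (c : ℂ) (u : V) :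
    L (c • u) = c • L u := by
  rw [smul_eq_re_add_im, smul_eq_re_add_im c (L u), map_add, map_smul, map_smul, hL]

theorem map_smul_of_map_I_smul_neg {L : V →ₗ[ℝ] W} (hL : ∀ u, L (I • u) = -(I • L u)) (c : ℂ)
    (u : V) : L (c • u) = starRingEnd ℂ c • L u := by
  rw [smul_eq_re_add_im, smul_eq_re_add_im _ (L u), map_add, map_smul, map_smul, hL, conj_re,
    conj_im, smul_neg, neg_smul]

theorem trace_restrictScalars_complex {ι : Type*} [Fintype ι] (b : Module.Basis ι ℂ V)
    (L : V →ₗ[ℂ] V) :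
    LinearMap.trace ℝ V (L.restrictScalars ℝ) = 2 * (∑ i, b.repr (L (b i)) i).re := by
  classical
  rw [LinearMap.trace_eq_matrix_trace ℝ (basisOneI.smulTower b)]
  simp only [Matrix.trace, Matrix.diag, LinearMap.toMatrix_apply, LinearMap.restrictScalars_apply,
    Module.Basis.smulTower_repr, Fintype.sum_prod_type, Fin.sum_univ_two,
    Module.Basis.smulTower_apply, coe_basisOneI, coe_basisOneI_repr, map_smul,
    Finsupp.smul_apply, re_sum]
  simp [← two_mul, Finset.mul_sum]

end ComplexLinear

section Kahler

open Complex

variable {E : Type*} [NormedAddCommGroup E] [NormedSpace ℂ E]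

theorem apply_I_left_of_hermitian {B : E →L[ℝ] E →L[ℝ] ℝ}
    (hB : ∀ u v, B (I • u) (I • v) = B u v) (u v : E) : B (I • u) v = -B u (I • v) := by
  rw [← hB, I_smul_I_smul, map_neg, neg_apply]

/-- `G` is a Kähler metric on the open set `U`: it is Hermitian, and multiplication by `i` is
parallel. -/
structure IsKahlerOn (G : E → E →L[ℝ] E →L[ℝ] ℝ) (U : Set E) : Prop extends IsMetricOn G U where
  hermitian : ∀ x ∈ U, ∀ u v : E, G x (I • u) (I • v) = G x u v
  christoffelCLM_I_right : ∀ x ∈ U, ∀ u v : E,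
    christoffelCLM G x u (I • v) = I • christoffelCLM G x u v

/-- The antiholomorphic derivative of the Christoffel symbols in the direction `b`, which
determines the curvature of a Kähler metric. -/
def dbarChristoffel (G : E → E →L[ℝ] E →L[ℝ] ℝ) (x : E) : E →L[ℝ] E →L[ℝ] E →L[ℝ] E :=
  (1 / 2 : ℂ) • (fderiv ℝ (christoffelCLM G) x + I • (fderiv ℝ (christoffelCLM G) x).comp mulI)

theorem dbarChristoffel_apply (G : E → E →L[ℝ] E →L[ℝ] ℝ) (x b v w : E) :
    dbarChristoffel G x b v w = (1 / 2 : ℂ) • (fderiv ℝ (christoffelCLM G) x b v w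
      + I • fderiv ℝ (christoffelCLM G) x (I • b) v w) := rfl

theorem dbarChristoffel_smul_left (G : E → E →L[ℝ] E →L[ℝ] ℝ) (x : E) (c : ℂ) (b v w : E) :
    dbarChristoffel G x (c • b) v w = starRingEnd ℂ c • dbarChristoffel G x b v w := by
  have hI (b : E) : dbarChristoffel G x (I • b) = -(I • dbarChristoffel G x b) := by
    ext v w
    simp only [dbarChristoffel_apply, smul_apply, neg_apply, I_smul_I_smul, map_neg]
    rw [smul_comm I, smul_add I, I_smul_I_smul]
    module
  exact congrArg (fun l : E →L[ℝ] E →L[ℝ] E => l v w)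
    (map_smul_of_map_I_smul_neg (L := (dbarChristoffel G x).toLinearMap) hI c b)

/-- The endomorphism `u ↦ R(u, v) w`, whose trace is the Ricci curvature. -/
def ricciOperator (G : E → E →L[ℝ] E →L[ℝ] ℝ) (x v w : E) : E →ₗ[ℝ] E where
  toFun u := fderiv ℝ (christoffelCLM G) x u v w - fderiv ℝ (christoffelCLM G) x v u w
      + christoffelCLM G x u (christoffelCLM G x v w)
      - christoffelCLM G x v (christoffelCLM G x u w)
  map_add' a b := by
    simp only [map_add, add_apply]
    abel
  map_smul' a b := by
    simp only [map_smul, smul_apply, RingHom.id_apply]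
    module

variable {G : E → E →L[ℝ] E →L[ℝ] ℝ} {U : Set E}

namespace IsMetricOn

variable [FiniteDimensional ℝ E]

theorem ricciOperator_apply (h : IsMetricOn G U) {x : E} (hx : x ∈ U) (u v w : E) :
    ricciOperator G x v w u = curvature G x u v w :=
  (h.curvature_eq hx u v w).symm

theorem ricci_eq_trace (h : IsMetricOn G U) {x : E} (hx : x ∈ U) (v w : E) :
    ricci G x v w = LinearMap.trace ℝ E (ricciOperator G x v w) := by
  classical
  rw [LinearMap.trace_eq_matrix_trace ℝ (Module.finBasis ℝ E)]
  simp [Matrix.trace, LinearMap.toMatrix_apply, ricci, Module.Basis.coord_apply,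
    h.ricciOperator_apply hx]

theorem isKahlerOn (h : IsMetricOn G U)
    (hherm : ∀ x ∈ U, ∀ u v : E, G x (I • u) (I • v) = G x u v)
    (hclosed : ∀ x ∈ U, ∀ u v w : E, fderiv ℝ G x u (I • v) w - fderiv ℝ G x v (I • u) w
      + fderiv ℝ G x w (I • u) v = 0) : IsKahlerOn G U := by
  refine ⟨h, hherm, fun x hx u v => ?_⟩
  have hd := h.differentiableAt hx
  have hherm' (a b c : E) : fderiv ℝ G x a (I • b) (I • c) = fderiv ℝ G x a b c := by
    rw [← fderiv_apply_const₂ hd, ← fderiv_apply_const₂ hd,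
      fderiv_eq_of_eqOn h.isOpen (fun y hy => hherm y hy b c) hx]
  have hskew (a b c : E) : fderiv ℝ G x a (I • b) c = -fderiv ℝ G x a b (I • c) :=
    apply_I_left_of_hermitian (hherm' a) b c
  rw [christoffelCLM_apply, christoffelCLM_apply]
  refine h.christoffel_eq hx fun w => ?_
  rw [apply_I_left_of_hermitian (hherm x hx), h.apply_christoffel hx]
  have h₁ := hclosed x hx u v w
  have h₂ := hclosed x hx u (I • v) (I • w)
  have h₃ := hclosed x hx u v (I • w)
  have h₄ := hclosed x hx u (I • v) w
  simp only [I_smul_I_smul, hherm', hskew, map_neg, neg_apply] at h₁ h₂ h₃ h₄ ⊢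
  linarith

end IsMetricOn

namespace IsKahlerOn

theorem apply_I_left (h : IsKahlerOn G U) {x : E} (hx : x ∈ U) (u v : E) :
    G x (I • u) v = -G x u (I • v) :=
  apply_I_left_of_hermitian (h.hermitian x hx) u v

theorem apply_I_self (h : IsKahlerOn G U) {x : E} (hx : x ∈ U) (u : E) : G x u (I • u) = 0 := by
  have hskew := h.apply_I_left hx u u
  rw [h.symm x hx] at hskew
  linarith

theorem sectional_I (h : IsKahlerOn G U) {x : E} (hx : x ∈ U) (u : E) :
    sectional G x u (I • u) = G x (curvature G x u (I • u) (I • u)) u / G x u u ^ 2 := by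
  rw [sectional, h.hermitian x hx, h.apply_I_self hx]
  ring_nf

variable [FiniteDimensional ℝ E]

theorem christoffelCLM_I_left (h : IsKahlerOn G U) {x : E} (hx : x ∈ U) (u v : E) :
    christoffelCLM G x (I • u) v = I • christoffelCLM G x u v := by
  rw [h.christoffelCLM_symm hx, h.christoffelCLM_I_right x hx, h.christoffelCLM_symm hx]

theorem fderiv_christoffelCLM_I_right (h : IsKahlerOn G U) {x : E} (hx : x ∈ U) (a u v : E) :
    fderiv ℝ (christoffelCLM G) x a u (I • v) = I • fderiv ℝ (christoffelCLM G) x a u v := by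
  have hd := h.differentiableAt_christoffelCLM hx
  rw [← fderiv_apply_const₂ hd, ← fderiv_apply_const₂ hd,
    fderiv_eq_of_eqOn h.isOpen (fun y hy => h.christoffelCLM_I_right y hy u v) hx,
    fderiv_fun_const_smul (by fun_prop), smul_apply]

theorem fderiv_christoffelCLM_I_left (h : IsKahlerOn G U) {x : E} (hx : x ∈ U) (a u v : E) :
    fderiv ℝ (christoffelCLM G) x a (I • u) v = I • fderiv ℝ (christoffelCLM G) x a u v := by
  rw [h.fderiv_christoffelCLM_symm hx, h.fderiv_christoffelCLM_I_right hx,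
    h.fderiv_christoffelCLM_symm hx]

theorem dbarChristoffel_symm (h : IsKahlerOn G U) {x : E} (hx : x ∈ U) (b v w : E) :
    dbarChristoffel G x b v w = dbarChristoffel G x b w v := by
  simp only [dbarChristoffel_apply, h.fderiv_christoffelCLM_symm hx _ v w]

theorem dbarChristoffel_smul_right (h : IsKahlerOn G U) {x : E} (hx : x ∈ U) (c : ℂ) (b v w : E) :
    dbarChristoffel G x b v (c • w) = c • dbarChristoffel G x b v w := by
  refine map_smul_of_map_I_smul (L := (dbarChristoffel G x b v).toLinearMap) (fun w => ?_) c w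
  simp only [ContinuousLinearMap.coe_coe, dbarChristoffel_apply,
    h.fderiv_christoffelCLM_I_right hx]
  module

theorem curvature_add_curvature_I (h : IsKahlerOn G U) {x : E} (hx : x ∈ U) (u v w : E) :
    curvature G x u v w + curvature G x u (I • v) (I • w) =
      (-2 : ℂ) • dbarChristoffel G x v u w := by
  rw [h.curvature_eq hx, h.curvature_eq hx, dbarChristoffel_apply]
  simp only [h.fderiv_christoffelCLM_I_right hx, h.fderiv_christoffelCLM_I_left hx,
    h.christoffelCLM_I_right x hx, h.christoffelCLM_I_left hx, I_smul_I_smul, map_neg]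
  module

theorem curvature_I_self (h : IsKahlerOn G U) {x : E} (hx : x ∈ U) (u : E) :
    curvature G x u (I • u) (I • u) = (-2 : ℂ) • dbarChristoffel G x u u u := by
  rw [← h.curvature_add_curvature_I hx, h.curvature_self hx, zero_add]

theorem curvature_I_right (h : IsKahlerOn G U) {x : E} (hx : x ∈ U) (u v w : E) :
    curvature G x u v (I • w) = I • curvature G x u v w := by
  rw [h.curvature_eq hx, h.curvature_eq hx]
  simp only [h.fderiv_christoffelCLM_I_right hx, h.christoffelCLM_I_right x hx]
  module

theorem curvature_eq_zero (h : IsKahlerOn G U) {x : E} (hx : x ∈ U)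
    (hdbar : dbarChristoffel G x = 0) (u v w : E) : curvature G x u v w = 0 := by
  have hI (w : E) : curvature G x u (I • v) w = I • curvature G x u v w := by
    have hsum := h.curvature_add_curvature_I hx u v w
    rw [hdbar, zero_apply, zero_apply, zero_apply, smul_zero, h.curvature_I_right hx,
      add_eq_zero_iff_eq_neg] at hsum
    rw [hsum, smul_neg, I_smul_I_smul, neg_neg]
  refine h.ext_apply hx fun t => ?_
  have hskewI := h.curvature_skew hx u (I • v) w (I • t)
  have hskew := h.curvature_skew hx u v w t
  rw [hI, hI, h.curvature_I_right hx, I_smul_I_smul, h.hermitian x hx] at hskewI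
  simp only [map_neg, map_zero, zero_apply] at hskewI ⊢
  linarith

/-- The complex endomorphism `u ↦ ∂̄_b Γ(u, w)`, whose trace is the complex Ricci form. -/
def dbarOperator (h : IsKahlerOn G U) {x : E} (hx : x ∈ U) (b w : E) : E →ₗ[ℂ] E where
  toFun u := dbarChristoffel G x b u w
  map_add' u v := by rw [map_add, add_apply]
  map_smul' c u := by
    rw [h.dbarChristoffel_symm hx, h.dbarChristoffel_smul_right hx, h.dbarChristoffel_symm hx,
      RingHom.id_apply]

theorem ricciOperator_add_ricciOperator_I (h : IsKahlerOn G U) {x : E} (hx : x ∈ U) (b w : E) :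
    ricciOperator G x b w + ricciOperator G x (I • b) (I • w) =
      ((-2 : ℂ) • h.dbarOperator hx b w).restrictScalars ℝ := by
  ext u
  rw [LinearMap.add_apply, h.ricciOperator_apply hx, h.ricciOperator_apply hx,
    h.curvature_add_curvature_I hx]
  rfl

theorem sum_repr_dbarChristoffel_eq_zero (h : IsKahlerOn G U) {x : E} (hx : x ∈ U)
    (hric : ∀ v w, ricci G x v w = 0) {ι : Type*} [Fintype ι] (e : Module.Basis ι ℂ E) (b w : E) :
    ∑ i, e.repr (dbarChristoffel G x b (e i) w) i = 0 := by
  have hre (w : E) : (∑ i, e.repr (dbarChristoffel G x b (e i) w) i).re = 0 := by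
    have htrace := trace_restrictScalars_complex e ((-2 : ℂ) • h.dbarOperator hx b w)
    rw [← h.ricciOperator_add_ricciOperator_I hx, map_add, ← h.ricci_eq_trace hx,
      ← h.ricci_eq_trace hx, hric, hric] at htrace
    simp only [LinearMap.smul_apply, map_smul, Finsupp.smul_apply, smul_eq_mul,
      ← Finset.mul_sum] at htrace
    simpa [dbarOperator] using htrace
  refine Complex.ext (hre w) ?_
  have him := hre (I • w)
  simp only [h.dbarChristoffel_smul_right hx, map_smul, Finsupp.smul_apply, smul_eq_mul,
    ← Finset.mul_sum] at him
  simpa using him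

end IsKahlerOn

/-- `φ` is a holomorphic immersion of the open set `V` into `U`. -/
structure IsHolomorphicImmersionOn (φ : E → E) (V U : Set E) : Prop extends
    IsImmersionOn φ V U where
  fderiv_I : ∀ x ∈ V, ∀ u : E, fderiv ℝ φ x (I • u) = I • fderiv ℝ φ x u

theorem IsHolomorphicImmersionOn.fderiv_fderiv_I {φ : E → E} {V : Set E}
    (hφ : IsHolomorphicImmersionOn φ V U) {x : E} (hx : x ∈ V) (u v : E) :
    fderiv ℝ (fderiv ℝ φ) x u (I • v) = I • fderiv ℝ (fderiv ℝ φ) x u v := by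
  have hφ' := hφ.differentiableAt_fderiv hx
  rw [← fderiv_apply_const hφ', ← fderiv_apply_const hφ',
    fderiv_eq_of_eqOn hφ.isOpen (fun y hy => hφ.fderiv_I y hy v) hx,
    fderiv_fun_const_smul (by fun_prop), smul_apply]

theorem IsKahlerOn.pullback [FiniteDimensional ℝ E] (h : IsKahlerOn G U) {φ : E → E} {V : Set E}
    (hφ : IsHolomorphicImmersionOn φ V U) : IsKahlerOn (pullbackMetric φ G) V where
  toIsMetricOn := h.toIsMetricOn.pullback hφ.toIsImmersionOn
  hermitian x hx u v := by
    rw [pullbackMetric_apply, hφ.fderiv_I x hx, hφ.fderiv_I x hx, h.hermitian _ (hφ.mapsTo hx),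
      pullbackMetric_apply]
  christoffelCLM_I_right x hx u v := by
    apply hφ.injective x hx
    rw [hφ.fderiv_I x hx, h.fderiv_christoffel_pullback hφ.toIsImmersionOn hx,
      h.fderiv_christoffel_pullback hφ.toIsImmersionOn hx, hφ.fderiv_I x hx,
      h.christoffelCLM_I_right _ (hφ.mapsTo hx), hφ.fderiv_fderiv_I hx, smul_add]

end Kahler

/-! ### The formal Laplacian of the holomorphic sectional curvature -/

section Formal

/-- A Kähler metric with respect to a frame of commuting holomorphic vector fields, seen from
inside the algebra `A` of smooth complex functions: the fields act on `A` by the derivations `del`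
and their conjugates by `delbar`, and the metric and its Christoffel symbols have components in `A`.
Computing with derivations of `A` makes the Laplacian of the curvature a formal identity. -/
structure FormalKahlerMetric (ι A : Type*) [Fintype ι] [CommRing A] [Algebra ℂ A] where
  del : ι → Derivation ℂ A A
  delbar : ι → Derivation ℂ A A
  metric : ι → ι → A
  christoffel : ι → ι → ι → A
  conjChristoffel : ι → ι → ι → A
  del_comm : ∀ i j x, del i (del j x) = del j (del i x)
  delbar_comm : ∀ i j x, delbar i (delbar j x) = delbar j (delbar i x)
  del_delbar_comm : ∀ i j x, del i (delbar j x) = delbar j (del i x)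
  christoffel_symm : ∀ i j l, christoffel i j l = christoffel j i l
  conjChristoffel_symm : ∀ i j l, conjChristoffel i j l = conjChristoffel j i l
  del_metric : ∀ k i j, del k (metric i j) = ∑ l, christoffel k i l * metric l j
  delbar_metric : ∀ k i j, delbar k (metric i j) = ∑ l, conjChristoffel k j l * metric i l

namespace FormalKahlerMetric

variable {ι A : Type*} [Fintype ι] [CommRing A] [Algebra ℂ A] (K : FormalKahlerMetric ι A)

/-- The curvature components, the upper index being the last one. -/
def curvature (b i j l : ι) : A := K.delbar b (K.christoffel i j l)

/-- The holomorphic sectional curvature in the direction `o` of the frame, up to normalisation. -/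
def sectional (o : ι) : A := ∑ l, K.curvature o o o l * K.metric l o

/-- The Laplacian at a point where the frame is unitary. -/
def laplacian : A →ₗ[ℂ] A := ∑ k, (K.del k : A →ₗ[ℂ] A) ∘ₗ (K.delbar k : A →ₗ[ℂ] A)

theorem laplacian_apply (f : A) : K.laplacian f = ∑ k, K.del k (K.delbar k f) := by
  simp [laplacian, LinearMap.sum_apply]

theorem del_metric_symm (k i j : ι) : K.del k (K.metric i j) = K.del i (K.metric k j) := by
  simp only [K.del_metric, K.christoffel_symm k i]

theorem delbar_metric_symm (k i j : ι) :
    K.delbar k (K.metric i j) = K.delbar j (K.metric i k) := by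
  simp only [K.delbar_metric, K.conjChristoffel_symm k j]

theorem sectional_eq (o : ι) :
    K.sectional o = K.delbar o (K.del o (K.metric o o))
      - ∑ l, K.christoffel o o l * K.delbar o (K.metric l o) := by
  rw [K.del_metric, map_sum, eq_sub_iff_add_eq, sectional, ← Finset.sum_add_distrib]
  refine Finset.sum_congr rfl fun l _ => ?_
  rw [curvature, Derivation.leibniz, smul_eq_mul, smul_eq_mul]
  ring

theorem del_delbar_fourth_symm (k o : ι) :
    K.del k (K.delbar k (K.delbar o (K.del o (K.metric o o)))) =
      K.del o (K.delbar o (K.delbar o (K.del o (K.metric k k)))) := by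
  simp only [K.del_delbar_comm]
  rw [K.del_comm k, K.del_metric_symm k o o, K.delbar_comm k, ← K.del_delbar_comm o k,
    ← K.del_delbar_comm o k, K.delbar_metric_symm k k o, K.del_delbar_comm, K.del_delbar_comm]

variable [DecidableEq ι]

/-- The point at which `ev` evaluates is the centre of normal coordinates. -/
structure IsNormalAt (ev : A →ₐ[ℂ] ℂ) : Prop where
  metric : ∀ i j, ev (K.metric i j) = if i = j then 1 else 0
  christoffel : ∀ i j l, ev (K.christoffel i j l) = 0
  conjChristoffel : ∀ i j l, ev (K.conjChristoffel i j l) = 0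

namespace IsNormalAt

variable {K} {ev : A →ₐ[ℂ] ℂ} (hK : K.IsNormalAt ev)
include hK

theorem del_metric (k i j : ι) : ev (K.del k (K.metric i j)) = 0 := by
  simp [K.del_metric, hK.christoffel]

theorem delbar_metric (k i j : ι) : ev (K.delbar k (K.metric i j)) = 0 := by
  simp [K.delbar_metric, hK.conjChristoffel]

theorem del_del_metric (a k i j : ι) :
    ev (K.del a (K.del k (K.metric i j))) = ev (K.del a (K.christoffel k i j)) := by
  simp [K.del_metric k, hK.del_metric, hK.christoffel, hK.metric]

theorem delbar_del_metric (a k i j : ι) :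
    ev (K.delbar a (K.del k (K.metric i j))) = ev (K.curvature a k i j) := by
  simp [K.del_metric k, curvature, hK.delbar_metric, hK.christoffel, hK.metric]

theorem del_delbar_metric (a k i j : ι) :
    ev (K.del a (K.delbar k (K.metric i j))) = ev (K.del a (K.conjChristoffel k j i)) := by
  simp [K.delbar_metric k, hK.del_metric, hK.conjChristoffel, hK.metric]

theorem delbar_delbar_metric (a k i j : ι) :
    ev (K.delbar a (K.delbar k (K.metric i j))) = ev (K.delbar a (K.conjChristoffel k j i)) := by
  simp [K.delbar_metric k, hK.delbar_metric, hK.conjChristoffel, hK.metric]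

theorem del_christoffel_symm (k i j l : ι) :
    ev (K.del k (K.christoffel i j l)) = ev (K.del i (K.christoffel k j l)) := by
  rw [← hK.del_del_metric, K.del_comm, hK.del_del_metric]

theorem delbar_conjChristoffel_symm (k i j l : ι) :
    ev (K.delbar k (K.conjChristoffel i j l)) = ev (K.delbar i (K.conjChristoffel k j l)) := by
  rw [← hK.delbar_delbar_metric, K.delbar_comm, hK.delbar_delbar_metric]

theorem curvature_eq_del_conjChristoffel (b i j l : ι) :
    ev (K.curvature b i j l) = ev (K.del i (K.conjChristoffel b l j)) := by
  rw [← hK.delbar_del_metric, ← K.del_delbar_comm, hK.del_delbar_metric]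

theorem curvature_symm_out (b i j l : ι) :
    ev (K.curvature b i j l) = ev (K.curvature l i j b) := by
  rw [hK.curvature_eq_del_conjChristoffel, hK.curvature_eq_del_conjChristoffel,
    K.conjChristoffel_symm]

theorem del_delbar_christoffel_mul_delbar_metric (k o l : ι) :
    ev (K.del k (K.delbar k (K.christoffel o o l * K.delbar o (K.metric l o)))) =
      ev (K.del o (K.christoffel o k l)) * ev (K.delbar o (K.conjChristoffel o k l))
      + ev (K.curvature k o o l) * ev (K.del k (K.conjChristoffel o o l)) := by
  rw [K.christoffel_symm o k, K.conjChristoffel_symm o k, hK.del_christoffel_symm o k,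
    hK.delbar_conjChristoffel_symm o k]
  simp only [Derivation.leibniz, smul_eq_mul, map_add, map_mul, hK.christoffel, hK.delbar_metric,
    hK.delbar_delbar_metric, hK.del_delbar_metric, curvature]
  ring

theorem laplacian_sum_christoffel_mul_delbar_metric (o : ι) :
    ev (K.laplacian (∑ l, K.christoffel o o l * K.delbar o (K.metric l o))) =
      ∑ k, ∑ l, ev (K.del o (K.christoffel o k l)) * ev (K.delbar o (K.conjChristoffel o k l))
      + ∑ k, ∑ l, ev (K.curvature k o o l) * ev (K.del k (K.conjChristoffel o o l)) := by
  rw [laplacian_apply, map_sum]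
  simp only [map_sum, hK.del_delbar_christoffel_mul_delbar_metric, Finset.sum_add_distrib]

theorem del_delbar_delbar_christoffel_mul_metric (o k l : ι) :
    ev (K.del o (K.delbar o (K.delbar o (K.christoffel o k l * K.metric l k)))) =
      ev (K.del o (K.delbar o (K.delbar o (K.christoffel o k l)))) * (if l = k then 1 else 0)
      + (2 * (ev (K.curvature o o k l) * ev (K.curvature o o l k))
        + ev (K.del o (K.christoffel o k l)) * ev (K.delbar o (K.conjChristoffel o k l))) := by
  simp only [Derivation.leibniz, smul_eq_mul, map_add, map_mul, hK.christoffel, hK.metric,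
    hK.delbar_metric, hK.del_metric, hK.delbar_delbar_metric, K.del_delbar_comm o o (K.metric l k),
    hK.delbar_del_metric, curvature]
  ring

theorem sum_del_delbar_fourth
    (hric : ∀ k j, K.delbar k (∑ l, K.christoffel j l l) = 0) (o : ι) :
    ev (∑ k, K.del o (K.delbar o (K.delbar o (K.del o (K.metric k k))))) =
      2 * ∑ k, ∑ l, ev (K.curvature o o k l) * ev (K.curvature o o l k)
      + ∑ k, ∑ l,
        ev (K.del o (K.christoffel o k l)) * ev (K.delbar o (K.conjChristoffel o k l)) := by
  have htrace : ∑ k, ev (K.del o (K.delbar o (K.delbar o (K.christoffel o k k)))) = 0 := by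
    simp only [← map_sum, hric, map_zero]
  simp only [K.del_metric, map_sum, hK.del_delbar_delbar_christoffel_mul_metric,
    Finset.sum_add_distrib, mul_ite, mul_one, mul_zero, Finset.sum_ite_eq', Finset.mem_univ,
    if_true, htrace, Finset.mul_sum, zero_add]

theorem laplacian_metric_mul_metric
    (hric : ∀ k j, K.delbar k (∑ l, K.christoffel j l l) = 0) (o : ι) :
    ev (K.laplacian (K.metric o o * K.metric o o)) = 0 := by
  have hterm (k : ι) : ev (K.del k (K.delbar k (K.metric o o * K.metric o o))) =
      2 * ev (K.curvature o o k k) := by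
    rw [hK.curvature_symm_out, curvature, K.christoffel_symm, ← curvature,
      ← hK.delbar_del_metric, ← K.del_delbar_comm]
    simp only [Derivation.leibniz, smul_eq_mul, map_add, map_mul, hK.metric, hK.del_metric,
      hK.delbar_metric, if_true]
    ring
  have htrace : ∑ k, ev (K.curvature o o k k) = 0 := by
    simp only [curvature, ← map_sum, hric, map_zero]
  rw [laplacian_apply, map_sum]
  simp only [hterm, ← Finset.mul_sum, htrace, mul_zero]

theorem laplacian_sectional
    (hric : ∀ k j, K.delbar k (∑ l, K.christoffel j l l) = 0) (o : ι) :
    ev (K.laplacian (K.sectional o)) =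
      2 * ∑ k, ∑ l, ev (K.curvature o o k l) * ev (K.curvature o o l k)
      - ∑ k, ∑ l, ev (K.curvature k o o l) * ev (K.del k (K.conjChristoffel o o l)) := by
  have hfourth : K.laplacian (K.delbar o (K.del o (K.metric o o))) =
      ∑ k, K.del o (K.delbar o (K.delbar o (K.del o (K.metric k k)))) := by
    simp only [laplacian_apply, K.del_delbar_fourth_symm _ o]
  rw [K.sectional_eq, map_sub, map_sub, hfourth, hK.sum_del_delbar_fourth hric,
    hK.laplacian_sum_christoffel_mul_delbar_metric]
  ring

end IsNormalAt

end FormalKahlerMetric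

end Formal

/-! ### The algebra of smooth functions -/

section SmoothFunctions

open TopologicalSpace Complex

theorem deriv_deriv_nonneg_of_isLocalMin {g : ℝ → ℝ} {t : ℝ} (hg : IsLocalMin g t)
    (hc : ContinuousAt g t) : 0 ≤ deriv (deriv g) t := by
  by_contra! hneg
  have hmax : IsLocalMax g t := isLocalMax_of_deriv_deriv_neg hneg hg.deriv_eq_zero hc
  have hconst : g =ᶠ[𝓝 t] fun _ => g t := by
    filter_upwards [hg, hmax] with s h1 h2 using le_antisymm h2 h1
  have hzero : deriv (deriv g) t = 0 := by
    rw [hconst.deriv.deriv_eq]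
    simp only [deriv_const', deriv_const]
  exact hneg.ne hzero

section Line

variable {E F : Type*} [NormedAddCommGroup E] [NormedSpace ℝ E] [NormedAddCommGroup F]
  [NormedSpace ℝ F] {f : E → F} {U : Set E} {x : E}

theorem deriv_comp_add_smul (v : E) {t : ℝ} (hf : DifferentiableAt ℝ f (x + t • v)) :
    deriv (fun t : ℝ => f (x + t • v)) t = fderiv ℝ f (x + t • v) v := by
  have hline : HasDerivAt (fun t : ℝ => x + t • v) v t := by
    simpa using ((hasDerivAt_id t).smul_const v).const_add x
  exact (hf.hasFDerivAt.comp_hasDerivAt t hline).deriv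

theorem deriv_deriv_comp_add_smul (hU : IsOpen U) (hf : ContDiffOn ℝ ∞ f U) (hx : x ∈ U) (v : E) :
    deriv (deriv fun t : ℝ => f (x + t • v)) 0 = fderiv ℝ (fun y => fderiv ℝ f y v) x v := by
  have hx0 : x + (0 : ℝ) • v ∈ U := by simpa using hx
  have hmem : ∀ᶠ t : ℝ in 𝓝 0, x + t • v ∈ U :=
    (by fun_prop : Continuous fun t : ℝ => x + t • v).continuousAt.eventually (hU.mem_nhds hx0)
  have hfirst : (deriv fun t : ℝ => f (x + t • v)) =ᶠ[𝓝 0] fun t => fderiv ℝ f (x + t • v) v := by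
    filter_upwards [hmem] with t ht
    exact deriv_comp_add_smul v (differentiableAt_of_contDiffOn hU hf ht)
  have hf' : ContDiffOn ℝ ∞ (fun y => fderiv ℝ f y v) U :=
    (contDiffOn_fderiv_of_isOpen hU hf).clm_apply contDiffOn_const
  rw [hfirst.deriv_eq, deriv_comp_add_smul v (f := fun y => fderiv ℝ f y v)
    (differentiableAt_of_contDiffOn hU hf' hx0), zero_smul, add_zero]

end Line

theorem fderiv_fderiv_nonneg_of_isLocalMin {E : Type*} [NormedAddCommGroup E] [NormedSpace ℝ E]
    {f : E → ℝ} {U : Set E} (hU : IsOpen U) (hf : ContDiffOn ℝ ∞ f U) {x : E} (hx : x ∈ U)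
    (hmin : IsLocalMin f x) (v : E) : 0 ≤ fderiv ℝ (fun y => fderiv ℝ f y v) x v := by
  have hline : ContinuousAt (fun t : ℝ => x + t • v) 0 := by fun_prop
  have hx0 : x + (0 : ℝ) • v = x := by simp
  have hmin' : IsLocalMin (fun t : ℝ => f (x + t • v)) 0 := by
    rw [← hx0] at hmin
    exact hmin.comp_tendsto (g := fun t : ℝ => x + t • v) hline
  have hcont : ContinuousAt f (x + (0 : ℝ) • v) :=
    hx0.symm ▸ (differentiableAt_of_contDiffOn hU hf hx).continuousAt
  rw [← deriv_deriv_comp_add_smul hU hf hx]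
  exact deriv_deriv_nonneg_of_isLocalMin hmin' (hcont.comp (f := fun t : ℝ => x + t • v) hline)

variable {E : Type*} [NormedAddCommGroup E] {U : Opens E}

/-- Extension by zero of a function on an open set, to which `fderiv` applies. -/
def extendZero (f : U → ℂ) : E → ℂ := Function.extend Subtype.val f 0

theorem extendZero_apply (f : U → ℂ) (x : U) : extendZero f x = f x :=
  Subtype.val_injective.extend_apply f 0 x

variable [NormedSpace ℝ E]

theorem contDiffOn_extendZero_iff {f : U → ℂ} {g : E → ℂ} (hfg : ∀ x : U, f x = g x) :
    ContDiffOn ℝ ∞ (extendZero f) U ↔ ContDiffOn ℝ ∞ g U :=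
  contDiffOn_congr fun x hx => (extendZero_apply f ⟨x, hx⟩).trans (hfg ⟨x, hx⟩)

variable (U) in
/-- The algebra of smooth complex functions on an open set. Its elements are functions on the
subtype, so that functions agreeing on the open set are equal. -/
def smoothAlgebra : Subalgebra ℂ (U → ℂ) where
  carrier := {f | ContDiffOn ℝ ∞ (extendZero f) U}
  mul_mem' {a b} ha hb := (contDiffOn_extendZero_iff (g := fun x => extendZero a x * extendZero b x)
    fun x => by simp [extendZero_apply]).2 (ContDiffOn.mul ha hb)
  add_mem' {a b} ha hb := (contDiffOn_extendZero_iff (g := fun x => extendZero a x + extendZero b x)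
    fun x => by simp [extendZero_apply]).2 (ContDiffOn.add ha hb)
  algebraMap_mem' r := (contDiffOn_extendZero_iff (g := fun _ => r) fun _ => rfl).2 contDiffOn_const

/-- The element of `smoothAlgebra U` given by a function that is smooth on `U`. -/
def toSmooth (f : E → ℂ) (hf : ContDiffOn ℝ ∞ f U) : smoothAlgebra U :=
  ⟨fun x => f x, (contDiffOn_extendZero_iff fun _ => rfl).2 hf⟩

theorem differentiableAt_extendZero (f : smoothAlgebra U) (x : U) :
    DifferentiableAt ℝ (extendZero f.1) x :=
  differentiableAt_of_contDiffOn U.isOpen f.2 x.2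

theorem fderiv_extendZero {f : smoothAlgebra U} {g : E → ℂ} (hfg : ∀ x : U, f.1 x = g x) (x : U) :
    fderiv ℝ (extendZero f.1) x = fderiv ℝ g x :=
  fderiv_eq_of_eqOn U.isOpen
    (fun y hy => (extendZero_apply f.1 ⟨y, hy⟩).trans (hfg ⟨y, hy⟩)) x.2

/-- The directional derivative, as a derivation of the algebra of smooth functions. -/
def dirDeriv (v : E) : Derivation ℂ (smoothAlgebra U) (smoothAlgebra U) :=
  Derivation.mk'
    { toFun := fun f => toSmooth (fun x => fderiv ℝ (extendZero f.1) x v)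
        ((contDiffOn_fderiv_of_isOpen U.isOpen f.2).clm_apply contDiffOn_const)
      map_add' := fun f g => by
        ext x
        change fderiv ℝ (extendZero (f + g).1) x v = _
        rw [fderiv_extendZero (f := f + g) (g := fun x => extendZero f.1 x + extendZero g.1 x)
          (fun x => by simp [extendZero_apply]), fderiv_fun_add (differentiableAt_extendZero f x)
          (differentiableAt_extendZero g x)]
        rfl
      map_smul' := fun c f => by
        ext x
        change fderiv ℝ (extendZero (c • f).1) x v = _
        rw [fderiv_extendZero (f := c • f) (g := fun x => c • extendZero f.1 x)
          (fun x => by simp [extendZero_apply]),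
          fderiv_fun_const_smul (differentiableAt_extendZero f x)]
        rfl }
    fun f g => by
      ext x
      change fderiv ℝ (extendZero (f * g).1) x v =
        f.1 x * fderiv ℝ (extendZero g.1) x v + g.1 x * fderiv ℝ (extendZero f.1) x v
      rw [fderiv_extendZero (f := f * g) (g := fun x => extendZero f.1 x * extendZero g.1 x)
          (fun x => by simp [extendZero_apply]), fderiv_fun_mul (differentiableAt_extendZero f x)
          (differentiableAt_extendZero g x)]
      simp [extendZero_apply]

theorem dirDeriv_apply (v : E) {f : smoothAlgebra U} {g : E → ℂ} (hfg : ∀ x : U, f.1 x = g x)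
    (x : U) : (dirDeriv v f).1 x = fderiv ℝ g x v := by
  rw [← fderiv_extendZero hfg]
  rfl

theorem dirDeriv_comm (v w : E) (f : smoothAlgebra U) :
    dirDeriv v (dirDeriv w f) = dirDeriv w (dirDeriv v f) := by
  ext x
  have hd : DifferentiableAt ℝ (fderiv ℝ (extendZero f.1)) x :=
    differentiableAt_of_contDiffOn U.isOpen (contDiffOn_fderiv_of_isOpen U.isOpen f.2) x.2
  rw [dirDeriv_apply v (g := fun x => fderiv ℝ (extendZero f.1) x w) (fun _ => rfl),
    dirDeriv_apply w (g := fun x => fderiv ℝ (extendZero f.1) x v) (fun _ => rfl),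
    fderiv_apply_const hd, fderiv_apply_const hd, fderiv_fderiv_comm U.isOpen f.2 x.2]

/-- Evaluation of smooth functions at a point. -/
def evalAt (x : U) : smoothAlgebra U →ₐ[ℂ] ℂ :=
  (Pi.evalAlgHom ℂ (fun _ : U => ℂ) x).comp (smoothAlgebra U).val

theorem evalAt_apply (x : U) (f : smoothAlgebra U) : evalAt x f = f.1 x := rfl

theorem fderiv_re_extendZero (f : smoothAlgebra U) (x : U) (v : E) :
    fderiv ℝ (fun y => (extendZero f.1 y).re) x v = (fderiv ℝ (extendZero f.1) x v).re :=
  DFunLike.congr_fun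
    (reCLM.hasFDerivAt.comp (x : E) (differentiableAt_extendZero f x).hasFDerivAt).fderiv v

theorem re_dirDeriv_dirDeriv_nonneg {f : smoothAlgebra U} {x : U}
    (hf : ∀ y, (f.1 x).re ≤ (f.1 y).re) (v : E) : 0 ≤ ((dirDeriv v (dirDeriv v f)).1 x).re := by
  have hmin : IsLocalMin (fun y => (extendZero f.1 y).re) x := by
    filter_upwards [U.isOpen.mem_nhds x.2] with y hy
    rw [extendZero_apply, ← Subtype.coe_mk y hy, extendZero_apply]
    exact hf ⟨y, hy⟩
  have hfst : Set.EqOn (fun y => fderiv ℝ (fun y => (extendZero f.1 y).re) y v)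
      (fun y => (extendZero (dirDeriv v f).1 y).re) U := fun y hy =>
    (fderiv_re_extendZero f ⟨y, hy⟩ v).trans
      (congrArg re (extendZero_apply (dirDeriv v f).1 ⟨y, hy⟩).symm)
  have hnonneg := fderiv_fderiv_nonneg_of_isLocalMin U.isOpen
    (reCLM.contDiff.comp_contDiffOn f.2) x.2 hmin v
  exact hnonneg.trans_eq ((congrArg (fun l => l v) (fderiv_eq_of_eqOn U.isOpen hfst x.2)).trans
    (fderiv_re_extendZero _ x v))

end SmoothFunctions

section Wirtinger

open TopologicalSpace Complex

variable {E : Type*} [NormedAddCommGroup E] [NormedSpace ℂ E] {U : Opens E}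

/-- The complex derivation `½ (D_v + ε D_{iv})`: the holomorphic derivative for `ε = -i` and the
antiholomorphic one for `ε = i`. -/
def wirtinger (ε : ℂ) (v : E) : Derivation ℂ (smoothAlgebra U) (smoothAlgebra U) :=
  (1 / 2 : ℂ) • ((dirDeriv v : Derivation ℂ (smoothAlgebra U) (smoothAlgebra U)) +
    ε • (dirDeriv (I • v) : Derivation ℂ (smoothAlgebra U) (smoothAlgebra U)))

theorem wirtinger_def (ε : ℂ) (v : E) (f : smoothAlgebra U) :
    wirtinger ε v f = (1 / 2 : ℂ) • (dirDeriv v f + ε • dirDeriv (I • v) f) := rfl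

theorem wirtinger_apply (ε : ℂ) (v : E) {f : smoothAlgebra U} {g : E → ℂ}
    (hfg : ∀ x : U, f.1 x = g x) (x : U) :
    (wirtinger ε v f).1 x = 1 / 2 * (fderiv ℝ g x v + ε * fderiv ℝ g x (I • v)) := by
  rw [← dirDeriv_apply v hfg, ← dirDeriv_apply (I • v) hfg]
  rfl

theorem wirtinger_comm (ε ε' : ℂ) (v w : E) (f : smoothAlgebra U) :
    wirtinger ε v (wirtinger ε' w f) = wirtinger ε' w (wirtinger ε v f) := by
  simp only [wirtinger_def, Derivation.map_smul, map_add, dirDeriv_comm v, dirDeriv_comm (I • v)]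
  module

theorem wirtinger_neg_I_wirtinger_I (v : E) (f : smoothAlgebra U) :
    wirtinger (-I) v (wirtinger I v f) =
      ((1 / 4 : ℝ) : ℂ) • (dirDeriv v (dirDeriv v f) + dirDeriv (I • v) (dirDeriv (I • v) f)) := by
  simp only [wirtinger_def, Derivation.map_smul, map_add, dirDeriv_comm (I • v) v]
  match_scalars
  · ring
  · ring
  · linear_combination (-1 / 4 : ℂ) * I_mul_I

theorem re_wirtinger_wirtinger_nonneg {f : smoothAlgebra U} {x : U}
    (hf : ∀ y, (f.1 x).re ≤ (f.1 y).re) (v : E) :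
    0 ≤ (evalAt x (wirtinger (-I) v (wirtinger I v f))).re := by
  rw [wirtinger_neg_I_wirtinger_I, map_smul, map_add, evalAt_apply, evalAt_apply, smul_eq_mul,
    re_ofReal_mul, add_re]
  have := re_dirDeriv_dirDeriv_nonneg hf v
  have := re_dirDeriv_dirDeriv_nonneg hf (I • v)
  positivity

theorem wirtinger_conj (ε : ℂ) (v : E) {f g : smoothAlgebra U}
    (hfg : ∀ x, g.1 x = starRingEnd ℂ (f.1 x)) (x : U) :
    evalAt x (wirtinger ε v g) = starRingEnd ℂ (evalAt x (wirtinger (starRingEnd ℂ ε) v f)) := by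
  have hconj (w : E) : fderiv ℝ (fun y => starRingEnd ℂ (extendZero f.1 y)) x w =
      starRingEnd ℂ (fderiv ℝ (extendZero f.1) x w) :=
    DFunLike.congr_fun ((conjCLE : ℂ →L[ℝ] ℂ).hasFDerivAt.comp (x : E)
      (differentiableAt_extendZero f x).hasFDerivAt).fderiv w
  rw [evalAt_apply, evalAt_apply,
    wirtinger_apply ε v (g := fun y => starRingEnd ℂ (extendZero f.1 y))
      (fun y => by rw [hfg, extendZero_apply]),
    wirtinger_apply _ v (g := extendZero f.1) (fun y => (extendZero_apply _ y).symm),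
    hconj, hconj]
  simp [conj_ofNat]

end Wirtinger

/-! ### Trace-free Kähler curvature tensors in complex dimension two -/

section CurvatureAlgebra

open Complex

/-- The symmetries of the components `S b i j l` (antilinear in `b` and `l`, linear in `i` and `j`)
of the curvature of a Ricci-flat Kähler metric in a unitary frame. -/
structure IsKahlerTensor {ι : Type*} [Fintype ι] (S : ι → ι → ι → ι → ℂ) : Prop where
  symm_mid : ∀ b i j l, S b i j l = S b j i l
  symm_out : ∀ b i j l, S b i j l = S l i j b
  conj : ∀ b i j l, starRingEnd ℂ (S b i j l) = S i b l j
  trace : ∀ b i, ∑ j, S b i j j = 0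

/-- The quartic form of a curvature tensor, which computes the holomorphic sectional curvatures. -/
def quarticForm {ι : Type*} [Fintype ι] (S : ι → ι → ι → ι → ℂ) (z : ι → ℂ) : ℂ :=
  ∑ b, ∑ i, ∑ j, ∑ l, S b i j l * z i * z j * starRingEnd ℂ (z b) * starRingEnd ℂ (z l)

/-- The quadratic expression in the curvature to which the Laplacian of the holomorphic sectional
curvature in the direction `o` reduces. -/
def reactionTerm {ι : Type*} [Fintype ι] (S : ι → ι → ι → ι → ℂ) (o : ι) : ℂ :=
  2 * ∑ k, ∑ l, S o o k l * S o o l k - ∑ k, ∑ l, S k o o l * starRingEnd ℂ (S k o o l)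

theorem quarticForm_single {ι : Type*} [Fintype ι] [DecidableEq ι] (S : ι → ι → ι → ι → ℂ) (o : ι) :
    quarticForm S (Pi.single o 1) = S o o o o := by
  simp [quarticForm, Pi.single_apply, apply_ite]

/-- The general trace-free curvature tensor of a Kähler surface, in terms of its three independent
components. -/
def kahlerTensor (a : ℝ) (β γ : ℂ) : Fin 2 → Fin 2 → Fin 2 → Fin 2 → ℂ :=
  ![![![![a, β], ![starRingEnd ℂ β, -a]],
      ![![starRingEnd ℂ β, -a], ![starRingEnd ℂ γ, -starRingEnd ℂ β]]],
    ![![![β, γ], ![-a, -β]],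
      ![![-a, -β], ![-starRingEnd ℂ β, a]]]]

theorem re_quarticForm_kahlerTensor (a : ℝ) (β γ w : ℂ) :
    (quarticForm (kahlerTensor a β γ) ![1, w]).re =
      a * (1 - 4 * normSq w + normSq w ^ 2) + 4 * (β * starRingEnd ℂ w).re * (1 - normSq w)
        + 2 * (γ * starRingEnd ℂ w ^ 2).re := by
  simp [quarticForm, kahlerTensor, Fin.sum_univ_two, normSq_apply, pow_two]
  ring

theorem re_quarticForm_kahlerTensor_of_normSq_eq_one (a : ℝ) (β γ : ℂ) {w : ℂ}
    (hw : normSq w = 1) : (quarticForm (kahlerTensor a β γ) ![1, w]).re =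
      2 * ((γ * starRingEnd ℂ w ^ 2).re - a) := by
  rw [re_quarticForm_kahlerTensor, hw]
  ring

theorem re_reactionTerm_kahlerTensor (a : ℝ) (β γ : ℂ) :
    (reactionTerm (kahlerTensor a β γ) 0).re = 3 * a ^ 2 + 2 * ‖β‖ ^ 2 - ‖γ‖ ^ 2 := by
  simp [reactionTerm, kahlerTensor, Fin.sum_univ_two, ← normSq_eq_norm_sq, normSq_apply]
  ring

theorem exists_normSq_eq_one_and_mul_conj_sq (γ : ℂ) :
    ∃ w : ℂ, normSq w = 1 ∧ γ * starRingEnd ℂ w ^ 2 = -‖γ‖ := by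
  refine ⟨I * exp ((γ.arg / 2 : ℝ) * I), ?_, ?_⟩
  · rw [normSq_eq_norm_sq, norm_mul, norm_exp_ofReal_mul_I, norm_I, mul_one, one_pow]
  · have hcancel : exp (γ.arg * I) * exp (-((γ.arg / 2 : ℝ) * I)) ^ 2 = 1 := by
      rw [← exp_nat_mul, ← exp_add, exp_eq_one_iff]
      exact ⟨0, by push_cast; ring⟩
    simp only [map_mul, conj_I, ← exp_conj, conj_ofReal, mul_pow, neg_sq, I_sq, mul_neg]
    linear_combination (-‖γ‖ : ℂ) * hcancel
      + exp (-((γ.arg / 2 : ℝ) * I)) ^ 2 * norm_mul_exp_arg_mul_I γ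

namespace IsKahlerTensor

variable {S : Fin 2 → Fin 2 → Fin 2 → Fin 2 → ℂ}

theorem eq_kahlerTensor (h : IsKahlerTensor S) :
    S = kahlerTensor (S 0 0 0 0).re (S 0 0 0 1) (S 1 0 0 1) := by
  have ht (b i : Fin 2) : S b i 1 1 = -S b i 0 0 :=
    eq_neg_of_add_eq_zero_right (by simpa only [Fin.sum_univ_two] using h.trace b i)
  have hreal : ((S 0 0 0 0).re : ℂ) = S 0 0 0 0 := conj_eq_iff_re.1 (h.conj 0 0 0 0)
  have h0010 : starRingEnd ℂ (S 0 0 0 1) = S 0 0 1 0 := h.conj 0 0 0 1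
  have h0110 : starRingEnd ℂ (S 1 0 0 1) = S 0 1 1 0 := h.conj 1 0 0 1
  have h0100 : S 0 1 0 0 = S 0 0 1 0 := h.symm_mid 0 1 0 0
  have h1000 : S 1 0 0 0 = S 0 0 0 1 := h.symm_out 1 0 0 0
  have h1010 : S 1 0 1 0 = -S 0 0 0 0 := (h.symm_out 1 0 1 0).trans (ht 0 0)
  have h1100 : S 1 1 0 0 = -S 0 0 0 0 := (h.symm_mid 1 1 0 0).trans h1010
  have h0101 : S 0 1 0 1 = -S 0 0 0 0 := (h.symm_out 0 1 0 1).trans h1100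
  have h1101 : S 1 1 0 1 = -S 0 0 0 1 := (h.symm_mid 1 1 0 1).trans ((ht 1 0).trans (by rw [h1000]))
  have h1110 : S 1 1 1 0 = -S 0 0 1 0 := (h.symm_out 1 1 1 0).trans ((ht 0 1).trans (by rw [h0100]))
  funext b i j l
  fin_cases b <;> fin_cases i <;> fin_cases j <;> fin_cases l <;>
    simp [kahlerTensor, ht, hreal, h0010, h0110, h0100, h1000, h1010, h1100, h0101, h1101, h1110]

theorem norm_le_of_le_re_quarticForm (h : IsKahlerTensor S) {b : ℝ}
    (hmin : ∀ z : Fin 2 → ℂ, b * (normSq (z 0) + normSq (z 1)) ^ 2 ≤ (quarticForm S z).re) :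
    ‖S 1 0 0 1‖ ≤ -(2 * b + (S 0 0 0 0).re) := by
  obtain ⟨w, hw, hγw⟩ := exists_normSq_eq_one_and_mul_conj_sq (S 1 0 0 1)
  have hle := hmin ![1, w]
  rw [h.eq_kahlerTensor, re_quarticForm_kahlerTensor_of_normSq_eq_one _ _ _ hw, hγw] at hle
  simp only [Matrix.cons_val_zero, Matrix.cons_val_one, normSq_one, hw, neg_re, ofReal_re] at hle
  linarith

/-- With `a = S 0 0 0 0` and `γ = S 1 0 0 1`, the real part is at least `3 * a ^ 2 - ‖γ‖ ^ 2`, and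
the lower bound gives `‖γ‖ ≤ (2 * c - 1) * a`; hence the constant `(1 + √3) / 2`. -/
theorem re_reactionTerm_pos (h : IsKahlerTensor S) {c : ℝ} (ha : 0 < (S 0 0 0 0).re)
    (hc : c < (1 + √3) / 2)
    (hmin : ∀ z : Fin 2 → ℂ,
      -(c * (S 0 0 0 0).re) * (normSq (z 0) + normSq (z 1)) ^ 2 ≤ (quarticForm S z).re) :
    0 < (reactionTerm S 0).re := by
  have hγ : ‖S 1 0 0 1‖ < √3 * (S 0 0 0 0).re := by
    nlinarith [h.norm_le_of_le_re_quarticForm hmin]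
  have hγsq : ‖S 1 0 0 1‖ ^ 2 < 3 * (S 0 0 0 0).re ^ 2 := by
    have := pow_lt_pow_left₀ hγ (norm_nonneg _) two_ne_zero
    rwa [mul_pow, Real.sq_sqrt (by norm_num)] at this
  rw [h.eq_kahlerTensor, re_reactionTerm_kahlerTensor]
  linarith [sq_nonneg ‖S 0 0 0 1‖]

/-- Being trace-free forces the average of the quartic form over the unit sphere to vanish. -/
theorem eq_zero_of_re_quarticForm_nonpos (h : IsKahlerTensor S)
    (hS : ∀ z : Fin 2 → ℂ, (quarticForm S z).re ≤ 0) : S = 0 := by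
  rw [h.eq_kahlerTensor] at hS ⊢
  generalize (S 0 0 0 0).re = a, S 0 0 0 1 = β, S 1 0 0 1 = γ at hS ⊢
  have hunit {w : ℂ} (hw : normSq w = 1) : (γ * starRingEnd ℂ w ^ 2).re ≤ a := by
    linarith [(re_quarticForm_kahlerTensor_of_normSq_eq_one a β γ hw).symm.trans_le (hS _)]
  have ha : a ≤ 0 := by simpa [re_quarticForm_kahlerTensor] using hS ![1, 0]
  have hγ : γ = 0 := by
    obtain ⟨w, hw, hγw⟩ := exists_normSq_eq_one_and_mul_conj_sq γ
    have hle := hunit (w := I * w) (by rw [normSq_mul, normSq_I, hw, one_mul])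
    have heq : γ * starRingEnd ℂ (I * w) ^ 2 = ‖γ‖ := by
      rw [map_mul, conj_I, mul_pow, neg_sq, I_sq]
      linear_combination -hγw
    rw [heq, ofReal_re] at hle
    exact norm_le_zero_iff.1 (hle.trans ha)
  have ha : a = 0 := le_antisymm ha (by simpa [hγ] using hunit normSq_one)
  have hβ : β = 0 := by
    have hβw (w : ℂ) (hw : normSq w < 1) : (β * starRingEnd ℂ w).re ≤ 0 := by
      have hle := hS ![1, w]
      rw [re_quarticForm_kahlerTensor, hγ, ha] at hle
      simp only [zero_mul, zero_re, mul_zero, zero_add, add_zero] at hle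
      nlinarith
    have hlt : normSq (((1 + ‖β‖)⁻¹ : ℝ) * β) < 1 := by
      rw [normSq_eq_norm_sq, norm_mul, norm_real, Real.norm_of_nonneg (by positivity),
        inv_mul_eq_div, sq_lt_one_iff₀ (by positivity), div_lt_one (by positivity)]
      exact lt_one_add _
    have hle := hβw _ hlt
    rw [map_mul, conj_ofReal, mul_left_comm, mul_conj, ← ofReal_mul, ofReal_re] at hle
    exact normSq_eq_zero.1 (le_antisymm (nonpos_of_mul_nonpos_right hle (by positivity))
      (normSq_nonneg β))
  funext b i j l
  fin_cases b <;> fin_cases i <;> fin_cases j <;> fin_cases l <;> simp [kahlerTensor, ha, hβ, hγ]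

end IsKahlerTensor

end CurvatureAlgebra

/-! ### Components in a frame -/

section Frame

open Complex

variable {E : Type*} [NormedAddCommGroup E] [NormedSpace ℂ E]

/-- The Hermitian form of a Hermitian metric, antilinear in the second variable. -/
def hermForm (G : E → E →L[ℝ] E →L[ℝ] ℝ) (x u v : E) : ℂ := G x u v + I * G x u (I • v)

/-- The components of the curvature in the frame `e`, the upper index being the last one. -/
def curvatureComponent {ι : Type*} (G : E → E →L[ℝ] E →L[ℝ] ℝ) (e : Module.Basis ι ℂ E) (x : E)
    (b i j l : ι) : ℂ :=
  e.repr (dbarChristoffel G x (e b) (e i) (e j)) l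

/-- The frame `e` is unitary at `x`. -/
def IsUnitaryAt {ι : Type*} [DecidableEq ι] (G : E → E →L[ℝ] E →L[ℝ] ℝ) (e : Module.Basis ι ℂ E)
    (x : E) : Prop :=
  ∀ i j, hermForm G x (e i) (e j) = if i = j then 1 else 0

variable {G : E → E →L[ℝ] E →L[ℝ] ℝ} {x : E}

theorem hermForm_re (u v : E) : (hermForm G x u v).re = G x u v := by simp [hermForm]

theorem hermForm_add_left (u u' v : E) :
    hermForm G x (u + u') v = hermForm G x u v + hermForm G x u' v := by
  simp [hermForm]
  ring

namespace IsKahlerOn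

variable {U : Set E} {ι : Type*} [Fintype ι]

theorem hermForm_conj (h : IsKahlerOn G U) (hx : x ∈ U) (u v : E) :
    starRingEnd ℂ (hermForm G x u v) = hermForm G x v u := by
  apply Complex.ext
  · simp [hermForm, h.symm x hx u v]
  · simp [hermForm, h.symm x hx v (I • u), h.apply_I_left hx u v]

theorem hermForm_smul_left (h : IsKahlerOn G U) (hx : x ∈ U) (c : ℂ) (u v : E) :
    hermForm G x (c • u) v = c * hermForm G x u v := by
  rw [smul_eq_re_add_im c u]
  apply Complex.ext
  · simp [hermForm, h.apply_I_left hx u v]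
    ring
  · simp [hermForm, h.hermitian x hx u v]

theorem hermForm_self (h : IsKahlerOn G U) (hx : x ∈ U) (u : E) :
    hermForm G x u u = G x u u := by
  simp [hermForm, h.apply_I_self hx]

theorem hermForm_sum_left (h : IsKahlerOn G U) (hx : x ∈ U) (e : Module.Basis ι ℂ E) (u v : E) :
    hermForm G x u v = ∑ l, e.repr u l * hermForm G x (e l) v := by
  let L : E →ₗ[ℂ] ℂ :=
    { toFun := fun u => hermForm G x u v
      map_add' := fun u u' => hermForm_add_left u u' v
      map_smul' := fun c u => h.hermForm_smul_left hx c u v }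
  calc L u = ∑ l, L (e.repr u l • e l) := by rw [← map_sum, e.sum_repr]
    _ = ∑ l, e.repr u l * L (e l) := by simp only [map_smul, smul_eq_mul]

theorem hermForm_sum_right (h : IsKahlerOn G U) (hx : x ∈ U) (e : Module.Basis ι ℂ E) (u v : E) :
    hermForm G x u v = ∑ l, starRingEnd ℂ (e.repr v l) * hermForm G x u (e l) := by
  rw [← h.hermForm_conj hx, h.hermForm_sum_left hx e, map_sum]
  simp only [map_mul, h.hermForm_conj hx]

omit [Fintype ι] in
theorem hermForm_eq_repr [Finite ι] [DecidableEq ι] (h : IsKahlerOn G U) (hx : x ∈ U)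
    {e : Module.Basis ι ℂ E} (he : IsUnitaryAt G e x) (w : E) (l : ι) :
    hermForm G x w (e l) = e.repr w l := by
  have := Fintype.ofFinite ι
  rw [h.hermForm_sum_left hx e]
  simp [he _ l]

theorem apply_self_eq [DecidableEq ι] (h : IsKahlerOn G U) (hx : x ∈ U)
    {e : Module.Basis ι ℂ E} (he : IsUnitaryAt G e x) (u : E) :
    G x u u = ∑ i, normSq (e.repr u i) := by
  rw [← hermForm_re, h.hermForm_sum_right hx e, re_sum]
  refine Finset.sum_congr rfl fun i _ => ?_
  rw [h.hermForm_eq_repr hx he, ← normSq_eq_conj_mul_self, ofReal_re]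

variable [FiniteDimensional ℝ E]

theorem dbarChristoffel_eq_sum (h : IsKahlerOn G U) (hx : x ∈ U) (e : Module.Basis ι ℂ E)
    (b v w : E) : dbarChristoffel G x b v w = ∑ a, ∑ i, ∑ j,
      (starRingEnd ℂ (e.repr b a) * e.repr v i * e.repr w j) •
        dbarChristoffel G x (e a) (e i) (e j) := by
  have hsmul (c : ℂ) (b v w : E) :
      dbarChristoffel G x b (c • v) w = c • dbarChristoffel G x b v w := by
    rw [h.dbarChristoffel_symm hx, h.dbarChristoffel_smul_right hx, h.dbarChristoffel_symm hx]
  have hright (b v : E) : dbarChristoffel G x b v w =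
      ∑ j, e.repr w j • dbarChristoffel G x b v (e j) := by
    simp only [← h.dbarChristoffel_smul_right hx, ← map_sum, e.sum_repr]
  have hmid (b w : E) : dbarChristoffel G x b v w =
      ∑ i, e.repr v i • dbarChristoffel G x b (e i) w := by
    simp only [← hsmul, ← sum_apply, ← map_sum, e.sum_repr]
  have hleft (v w : E) : dbarChristoffel G x b v w =
      ∑ a, starRingEnd ℂ (e.repr b a) • dbarChristoffel G x (e a) v w := by
    simp only [← dbarChristoffel_smul_left, ← sum_apply, ← map_sum, e.sum_repr]
  rw [hleft]
  simp only [hmid _ w, hright _ (e _), Finset.smul_sum, smul_smul, mul_assoc]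

omit [Fintype ι] in
theorem dbarChristoffel_eq_zero [Finite ι] (h : IsKahlerOn G U) (hx : x ∈ U)
    (e : Module.Basis ι ℂ E) (h0 : curvatureComponent G e x = 0) : dbarChristoffel G x = 0 := by
  have := Fintype.ofFinite ι
  have hframe (b i j : ι) : dbarChristoffel G x (e b) (e i) (e j) = 0 :=
    e.ext_elem fun l => (congrFun (congrFun (congrFun (congrFun h0 b) i) j) l).trans
      (by rw [map_zero]; rfl)
  ext b v w
  simp only [h.dbarChristoffel_eq_sum hx e b, hframe, smul_zero, Finset.sum_const_zero, zero_apply]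

theorem hermForm_dbarChristoffel [DecidableEq ι] (h : IsKahlerOn G U) (hx : x ∈ U)
    {e : Module.Basis ι ℂ E} (he : IsUnitaryAt G e x) (u : E) :
    hermForm G x (dbarChristoffel G x u u u) u =
      quarticForm (curvatureComponent G e x) (e.repr u) := by
  have hcomponent (l : ι) : e.repr (dbarChristoffel G x u u u) l = ∑ b, ∑ i, ∑ j,
      starRingEnd ℂ (e.repr u b) * e.repr u i * e.repr u j * curvatureComponent G e x b i j l := by
    rw [h.dbarChristoffel_eq_sum hx e]
    simp only [map_sum, map_smul, Finsupp.coe_finsetSum, Finset.sum_apply, Finsupp.smul_apply,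
      smul_eq_mul, curvatureComponent]
  rw [h.hermForm_sum_right hx e, quarticForm]
  simp only [h.hermForm_eq_repr hx he, hcomponent, Finset.mul_sum]
  rw [Finset.sum_comm]
  refine Finset.sum_congr rfl fun b _ => ?_
  rw [Finset.sum_comm]
  refine Finset.sum_congr rfl fun i _ => ?_
  rw [Finset.sum_comm]
  refine Finset.sum_congr rfl fun j _ => Finset.sum_congr rfl fun l _ => ?_
  ring

theorem apply_curvature_eq [DecidableEq ι] (h : IsKahlerOn G U) (hx : x ∈ U)
    {e : Module.Basis ι ℂ E} (he : IsUnitaryAt G e x) (u : E) :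
    G x (curvature G x u (I • u) (I • u)) u =
      -2 * (quarticForm (curvatureComponent G e x) (e.repr u)).re := by
  rw [← h.hermForm_dbarChristoffel hx he, h.curvature_I_self hx, ← hermForm_re,
    h.hermForm_smul_left hx]
  simp

end IsKahlerOn

end Frame

/-! ### The maximum principle for the holomorphic sectional curvature -/

section MaximumPrinciple

open Complex TopologicalSpace

variable {E : Type*} [NormedAddCommGroup E] [NormedSpace ℂ E]
variable {G : E → E →L[ℝ] E →L[ℝ] ℝ}

theorem IsKahlerOn.contDiffOn_hermForm {U : Set E} (h : IsKahlerOn G U) (u v : E) :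
    ContDiffOn ℝ ∞ (fun x => hermForm G x u v) U :=
  have hreal (w : E) : ContDiffOn ℝ ∞ (fun x => (G x u w : ℂ)) U :=
    ofRealCLM.contDiff.comp_contDiffOn
      ((h.smooth.clm_apply contDiffOn_const).clm_apply contDiffOn_const)
  (hreal v).add (contDiffOn_const.mul (hreal (I • v)))

variable [FiniteDimensional ℝ E] {ι : Type*}

/-- The coordinates in a complex basis, as continuous real linear maps. -/
def coordReal (e : Module.Basis ι ℂ E) (l : ι) : E →L[ℝ] ℂ :=
  LinearMap.toContinuousLinearMap ((e.coord l).restrictScalars ℝ)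

theorem coordReal_apply (e : Module.Basis ι ℂ E) (l : ι) (u : E) :
    coordReal e l u = e.repr u l := rfl

namespace IsKahlerOn

theorem fderiv_hermForm {U : Set E} (h : IsKahlerOn G U) {x : E} (hx : x ∈ U) (a u v : E) :
    fderiv ℝ (fun x => hermForm G x u v) x a =
      hermForm G x (christoffelCLM G x a u) v + hermForm G x u (christoffelCLM G x a v) := by
  have hd := h.differentiableAt hx
  have hreal (w : E) : HasFDerivAt (fun x => (G x u w : ℂ))
      (ofRealCLM.comp (fderiv ℝ (fun x => G x u w) x)) x :=
    ofRealCLM.hasFDerivAt.comp x (by fun_prop : DifferentiableAt ℝ (fun x => G x u w) x).hasFDerivAt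
  refine (congrArg (fun l : E →L[ℝ] ℂ => l a)
    ((hreal v).add ((hreal (I • v)).const_mul I)).fderiv).trans ?_
  simp only [add_apply, smul_apply, ContinuousLinearMap.comp_apply, fderiv_apply_const₂ hd,
    h.fderiv_eq hx, ofRealCLM_apply, smul_eq_mul, hermForm, h.christoffelCLM_I_right x hx]
  push_cast
  ring

variable {U : Opens E}

/-- The components of the metric in a frame, as smooth functions. -/
def metricComponent (h : IsKahlerOn G (U : Set E)) (e : Module.Basis ι ℂ E) (i j : ι) :
    smoothAlgebra U :=
  toSmooth (fun x => hermForm G x (e i) (e j)) (h.contDiffOn_hermForm _ _)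

/-- The components of the Christoffel symbols in a frame, as smooth functions. -/
def christoffelComponent (h : IsKahlerOn G (U : Set E)) (e : Module.Basis ι ℂ E) (i j l : ι) :
    smoothAlgebra U :=
  toSmooth (fun x => coordReal e l (christoffelCLM G x (e i) (e j)))
    ((coordReal e l).contDiff.comp_contDiffOn
      ((h.contDiffOn_christoffelCLM.clm_apply contDiffOn_const).clm_apply contDiffOn_const))

/-- The complex conjugates of the components of the Christoffel symbols. -/
def conjChristoffelComponent (h : IsKahlerOn G (U : Set E)) (e : Module.Basis ι ℂ E)
    (i j l : ι) : smoothAlgebra U :=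
  toSmooth (fun x => conjCLE (coordReal e l (christoffelCLM G x (e i) (e j))))
    (conjCLE.contDiff.comp_contDiffOn ((coordReal e l).contDiff.comp_contDiffOn
      ((h.contDiffOn_christoffelCLM.clm_apply contDiffOn_const).clm_apply contDiffOn_const)))

theorem wirtinger_christoffelComponent (h : IsKahlerOn G (U : Set E)) (e : Module.Basis ι ℂ E)
    (b i j l : ι) (x : U) :
    (wirtinger I (e b) (h.christoffelComponent e i j l)).1 x =
      curvatureComponent G e x b i j l := by
  have hd := h.differentiableAt_christoffelCLM x.2
  have hcoord (a : E) : fderiv ℝ (fun x => coordReal e l (christoffelCLM G x (e i) (e j))) x a =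
      coordReal e l (fderiv ℝ (christoffelCLM G) x a (e i) (e j)) := by
    rw [← fderiv_apply_const₂ hd]
    exact DFunLike.congr_fun ((coordReal e l).hasFDerivAt.comp (x : E) (by fun_prop :
      DifferentiableAt ℝ (fun x => christoffelCLM G x (e i) (e j)) x).hasFDerivAt).fderiv a
  rw [wirtinger_apply I (e b)
    (g := fun x => coordReal e l (christoffelCLM G x (e i) (e j))) (fun _ => rfl), hcoord, hcoord]
  simp [curvatureComponent, dbarChristoffel_apply, coordReal_apply, mul_add]

theorem wirtinger_metricComponent (h : IsKahlerOn G (U : Set E)) (e : Module.Basis ι ℂ E) (ε : ℂ)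
    (k i j : ι) (x : U) : (wirtinger ε (e k) (h.metricComponent e i j)).1 x =
      1 / 2 * ((1 + ε * I) * hermForm G x (christoffelCLM G x (e k) (e i)) (e j)
        + (1 - ε * I) * hermForm G x (e i) (christoffelCLM G x (e k) (e j))) := by
  have hright : hermForm G x (e i) (I • christoffelCLM G x (e k) (e j)) =
      -I * hermForm G x (e i) (christoffelCLM G x (e k) (e j)) := by
    rw [← h.hermForm_conj x.2, h.hermForm_smul_left x.2, map_mul, h.hermForm_conj x.2, conj_I]
  rw [wirtinger_apply ε (e k) (g := fun x => hermForm G x (e i) (e j)) (fun _ => rfl),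
    h.fderiv_hermForm x.2, h.fderiv_hermForm x.2, h.christoffelCLM_I_left x.2,
    h.christoffelCLM_I_left x.2, h.hermForm_smul_left x.2, hright]
  ring

variable [Fintype ι]

theorem wirtinger_neg_I_metricComponent (h : IsKahlerOn G (U : Set E)) (e : Module.Basis ι ℂ E)
    (k i j : ι) : wirtinger (-I) (e k) (h.metricComponent e i j) =
      ∑ l, h.christoffelComponent e k i l * h.metricComponent e l j := by
  ext x
  have hsum : (∑ l, h.christoffelComponent e k i l * h.metricComponent e l j).1 x =
      hermForm G x (christoffelCLM G x (e k) (e i)) (e j) := by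
    rw [h.hermForm_sum_left x.2 e, ← evalAt_apply, map_sum]
    rfl
  rw [hsum, h.wirtinger_metricComponent, neg_mul, I_mul_I]
  ring

theorem wirtinger_I_metricComponent (h : IsKahlerOn G (U : Set E)) (e : Module.Basis ι ℂ E)
    (k i j : ι) : wirtinger I (e k) (h.metricComponent e i j) =
      ∑ l, h.conjChristoffelComponent e k j l * h.metricComponent e i l := by
  ext x
  have hsum : (∑ l, h.conjChristoffelComponent e k j l * h.metricComponent e i l).1 x =
      hermForm G x (e i) (christoffelCLM G x (e k) (e j)) := by
    rw [h.hermForm_sum_right x.2 e, ← evalAt_apply, map_sum]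
    rfl
  rw [hsum, h.wirtinger_metricComponent, I_mul_I]
  ring

/-- The components of a Kähler metric in a frame of constant holomorphic vector fields. -/
def formalMetric (h : IsKahlerOn G (U : Set E)) (e : Module.Basis ι ℂ E) :
    FormalKahlerMetric ι (smoothAlgebra U) where
  del k := wirtinger (-I) (e k)
  delbar k := wirtinger I (e k)
  metric := h.metricComponent e
  christoffel := h.christoffelComponent e
  conjChristoffel := h.conjChristoffelComponent e
  del_comm _ _ := wirtinger_comm _ _ _ _
  delbar_comm _ _ := wirtinger_comm _ _ _ _
  del_delbar_comm _ _ := wirtinger_comm _ _ _ _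
  christoffel_symm i j l := by
    ext x
    exact congrArg (coordReal e l) (h.christoffelCLM_symm x.2 (e i) (e j))
  conjChristoffel_symm i j l := by
    ext x
    exact congrArg (conjCLE ∘ coordReal e l) (h.christoffelCLM_symm x.2 (e i) (e j))
  del_metric := h.wirtinger_neg_I_metricComponent e
  delbar_metric := h.wirtinger_I_metricComponent e

section Frame

variable (h : IsKahlerOn G (U : Set E)) (e : Module.Basis ι ℂ E) {x : U}

include h

theorem evalAt_curvature (b i j l : ι) :
    evalAt x ((h.formalMetric e).curvature b i j l) = curvatureComponent G e x b i j l :=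
  h.wirtinger_christoffelComponent e b i j l x

theorem evalAt_del_conjChristoffel (b i j l : ι) :
    evalAt x ((h.formalMetric e).del b ((h.formalMetric e).conjChristoffel i j l)) =
      starRingEnd ℂ (curvatureComponent G e x b i j l) := by
  refine (wirtinger_conj (-I) (e b) (f := h.christoffelComponent e i j l)
    (fun _ => rfl) x).trans ?_
  rw [map_neg, conj_I, neg_neg, evalAt_apply, h.wirtinger_christoffelComponent]

theorem evalAt_sectional (o : ι) : evalAt x ((h.formalMetric e).sectional o) =
    hermForm G x (dbarChristoffel G x (e o) (e o) (e o)) (e o) := by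
  rw [FormalKahlerMetric.sectional, map_sum, h.hermForm_sum_left x.2 e]
  simp only [map_mul, h.evalAt_curvature]
  rfl

theorem delbar_sum_christoffel_eq_zero (hric : ∀ y ∈ U, ∀ v w, ricci G y v w = 0) (k j : ι) :
    (h.formalMetric e).delbar k (∑ l, (h.formalMetric e).christoffel j l l) = 0 := by
  ext y
  rw [map_sum, ← evalAt_apply, map_sum]
  refine Eq.trans (Finset.sum_congr rfl fun l _ => (h.evalAt_curvature e k j l l).trans ?_)
    (h.sum_repr_dbarChristoffel_eq_zero y.2 (hric y y.2) e (e k) (e j))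
  rw [curvatureComponent, h.dbarChristoffel_symm y.2]

theorem re_laplacian_nonneg {f : smoothAlgebra U} (hf : ∀ y, (f.1 x).re ≤ (f.1 y).re) :
    0 ≤ (evalAt x ((h.formalMetric e).laplacian f)).re := by
  rw [FormalKahlerMetric.laplacian_apply, map_sum, re_sum]
  exact Finset.sum_nonneg fun k _ => re_wirtinger_wirtinger_nonneg hf (e k)

variable {e} [DecidableEq ι] (hΓ : christoffelCLM G x = 0) (he : IsUnitaryAt G e x)

include hΓ he

theorem isNormalAt : (h.formalMetric e).IsNormalAt (evalAt x) where
  metric := he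
  christoffel i j l := by
    change coordReal e l (christoffelCLM G x (e i) (e j)) = 0
    rw [hΓ, zero_apply, zero_apply, map_zero]
  conjChristoffel i j l := by
    change conjCLE (coordReal e l (christoffelCLM G x (e i) (e j))) = 0
    rw [hΓ, zero_apply, zero_apply, map_zero, map_zero]

theorem isKahlerTensor (hric : ∀ v w, ricci G x v w = 0) :
    IsKahlerTensor (curvatureComponent G e x) where
  symm_mid b i j l := by rw [curvatureComponent, h.dbarChristoffel_symm x.2, curvatureComponent]
  symm_out b i j l := by
    simpa only [h.evalAt_curvature] using (h.isNormalAt hΓ he).curvature_symm_out b i j l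
  conj b i j l := by
    have hcurv := (h.isNormalAt hΓ he).curvature_eq_del_conjChristoffel b i j l
    rw [h.evalAt_curvature, h.evalAt_del_conjChristoffel] at hcurv
    rw [hcurv, conj_conj]
  trace b i := by
    simp only [curvatureComponent, h.dbarChristoffel_symm x.2 _ (e i)]
    exact h.sum_repr_dbarChristoffel_eq_zero x.2 hric e (e b) (e i)

theorem evalAt_laplacian_sectional (hric : ∀ y ∈ U, ∀ v w, ricci G y v w = 0) (o : ι) :
    evalAt x ((h.formalMetric e).laplacian ((h.formalMetric e).sectional o)) =
      reactionTerm (curvatureComponent G e x) o := by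
  rw [(h.isNormalAt hΓ he).laplacian_sectional (h.delbar_sum_christoffel_eq_zero e hric)]
  simp only [h.evalAt_curvature, h.evalAt_del_conjChristoffel, reactionTerm]

theorem re_reactionTerm_nonpos_of_isMin (hric : ∀ y ∈ U, ∀ v w, ricci G y v w = 0) {m : ℝ} {o : ι}
    (hmin : ∀ y ∈ U, m * G y (e o) (e o) ^ 2 ≤
      G y (curvature G y (e o) (I • e o) (I • e o)) (e o))
    (heq : G x (curvature G x (e o) (I • e o) (I • e o)) (e o) = m) :
    (reactionTerm (curvatureComponent G e x) o).re ≤ 0 := by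
  set K := h.formalMetric e
  have hK : K.IsNormalAt (evalAt x) := h.isNormalAt hΓ he
  set f : smoothAlgebra U :=
    (-2 : ℂ) • K.sectional o - (m : ℂ) • (K.metric o o * K.metric o o) with hf
  have hf_apply (y : U) : (f.1 y).re =
      G y (curvature G y (e o) (I • e o) (I • e o)) (e o) - m * G y (e o) (e o) ^ 2 := by
    have hmetric : evalAt y (K.metric o o) = G y (e o) (e o) := h.hermForm_self y.2 (e o)
    rw [h.curvature_I_self y.2, ← hermForm_re, h.hermForm_smul_left y.2, ← h.evalAt_sectional,
      ← evalAt_apply, hf, map_sub, map_smul, map_smul, map_mul, hmetric, smul_eq_mul, smul_eq_mul,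
      sub_re, ← ofReal_mul, ← ofReal_mul, ofReal_re, ← pow_two]
  have hunit : G x (e o) (e o) = 1 := by rw [← hermForm_re, he, if_pos rfl, one_re]
  have hlaplacian : 0 ≤ (evalAt x (K.laplacian f)).re := by
    refine h.re_laplacian_nonneg e fun y => ?_
    rw [hf_apply, hf_apply, heq, hunit, one_pow, mul_one, sub_self]
    exact sub_nonneg.2 (hmin y y.2)
  rw [hf, map_sub, map_smul, map_smul, map_sub, map_smul, map_smul,
    hK.laplacian_metric_mul_metric (h.delbar_sum_christoffel_eq_zero e hric),
    h.evalAt_laplacian_sectional hΓ he hric, smul_zero, sub_zero, smul_eq_mul,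
    ← ofReal_ofNat, ← ofReal_neg, re_ofReal_mul] at hlaplacian
  linarith

end Frame

variable (h : IsKahlerOn G (U : Set E)) {e : Module.Basis (Fin 2) ℂ E} {x : U}
  (hΓ : christoffelCLM G x = 0) (he : IsUnitaryAt G e x)

include h hΓ he

theorem nonneg_of_isMin (hric : ∀ y ∈ U, ∀ v w, ricci G y v w = 0) {m c : ℝ}
    (hc : c < (1 + √3) / 2)
    (hmin : ∀ y ∈ U, m * G y (e 0) (e 0) ^ 2 ≤
      G y (curvature G y (e 0) (I • e 0) (I • e 0)) (e 0))
    (heq : G x (curvature G x (e 0) (I • e 0) (I • e 0)) (e 0) = m)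
    (hmax : ∀ u, G x (curvature G x u (I • u) (I • u)) u ≤ -c * m * G x u u ^ 2) : 0 ≤ m := by
  by_contra! hm
  have hcomponent : m = -2 * (curvatureComponent G e x 0 0 0 0).re := by
    rw [← heq, h.apply_curvature_eq x.2 he, e.repr_self, Finsupp.single_eq_pi_single,
      quarticForm_single]
  refine ((h.isKahlerTensor hΓ he (hric x x.2)).re_reactionTerm_pos (by linarith) hc
    fun z => ?_).not_ge (h.re_reactionTerm_nonpos_of_isMin hΓ he hric hmin heq)
  have hmax' := hmax (e.equivFun.symm z)
  rw [h.apply_curvature_eq x.2 he, h.apply_self_eq x.2 he, Fin.sum_univ_two,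
    ← e.equivFun_apply, e.equivFun.apply_symm_apply, hcomponent] at hmax'
  linarith

theorem curvature_eq_zero_of_nonneg (hric : ∀ v w, ricci G x v w = 0)
    (hnonneg : ∀ u, 0 ≤ G x (curvature G x u (I • u) (I • u)) u) (u v w : E) :
    curvature G x u v w = 0 := by
  refine h.curvature_eq_zero x.2 (h.dbarChristoffel_eq_zero x.2 e <|
    (h.isKahlerTensor hΓ he hric).eq_zero_of_re_quarticForm_nonpos fun z => ?_) u v w
  have hz := hnonneg (e.equivFun.symm z)
  rw [h.apply_curvature_eq x.2 he, ← e.equivFun_apply, e.equivFun.apply_symm_apply] at hz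
  linarith

end IsKahlerOn

end MaximumPrinciple

/-! ### Unitary frames and normal coordinates -/

section NormalCoordinates

open Complex TopologicalSpace

variable {E : Type*} [NormedAddCommGroup E] [NormedSpace ℂ E]
  {G : E → E →L[ℝ] E →L[ℝ] ℝ} {U : Set E}

namespace IsKahlerOn

theorem hermForm_normalize (h : IsKahlerOn G U) {x : E} (hx : x ∈ U) {u : E} (hu : u ≠ 0) :
    hermForm G x ((√(G x u u))⁻¹ • u) ((√(G x u u))⁻¹ • u) = 1 := by
  have hpos := h.pos x hx u hu
  rw [h.hermForm_self hx, map_smul, map_smul, smul_apply, smul_eq_mul, smul_eq_mul, ← mul_assoc,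
    ← mul_inv, Real.mul_self_sqrt hpos.le, inv_mul_cancel₀ hpos.ne', ofReal_one]

theorem linearIndependent_of_hermForm (h : IsKahlerOn G U) {x : E} (hx : x ∈ U) {ι : Type*}
    [DecidableEq ι] {v : ι → E} (hv : ∀ i j, hermForm G x (v i) (v j) = if i = j then 1 else 0) :
    LinearIndependent ℂ v := by
  refine linearIndependent_iff'.2 fun s c hc i hi => ?_
  let L : E →ₗ[ℂ] ℂ :=
    { toFun := fun u => hermForm G x u (v i)
      map_add' := fun u u' => hermForm_add_left u u' (v i)
      map_smul' := fun c u => h.hermForm_smul_left hx c u (v i) }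
  have hL (j : ι) : L (v j) = if j = i then 1 else 0 := hv j i
  simpa [hL, hi] using congrArg L hc

theorem exists_isUnitaryAt (h : IsKahlerOn G U) (hE : Module.finrank ℂ E = 2) {x : E} (hx : x ∈ U)
    {u : E} (hu : u ≠ 0) :
    ∃ e : Module.Basis (Fin 2) ℂ E, IsUnitaryAt G e x ∧ e 0 = (√(G x u u))⁻¹ • u := by
  set a : E := (√(G x u u))⁻¹ • u
  have haa : hermForm G x a a = 1 := h.hermForm_normalize hx hu
  have ha0 : a ≠ 0 := smul_ne_zero (inv_ne_zero (Real.sqrt_ne_zero'.2 (h.pos x hx u hu))) hu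
  obtain ⟨v, hv⟩ := exists_linearIndependent_pair_of_one_lt_finrank (R := ℂ)
    (by rw [hE]; exact one_lt_two) ha0
  set w : E := v + (-hermForm G x v a) • a with hw
  have hw0 : w ≠ 0 := fun h0 =>
    one_ne_zero (LinearIndependent.pair_iff.1 hv (-hermForm G x v a) 1
      (by rw [one_smul, add_comm, ← hw, h0])).2
  have hwa : hermForm G x w a = 0 := by
    rw [hw, hermForm_add_left, h.hermForm_smul_left hx, haa, mul_one, add_neg_cancel]
  set b : E := (√(G x w w))⁻¹ • w with hb
  have hbb : hermForm G x b b = 1 := h.hermForm_normalize hx hw0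
  have hba : hermForm G x b a = 0 := by
    rw [hb, ← coe_smul, h.hermForm_smul_left hx, hwa, mul_zero]
  have hab : hermForm G x a b = 0 := by rw [← h.hermForm_conj hx, hba, map_zero]
  have hunitary (i j : Fin 2) : hermForm G x (![a, b] i) (![a, b] j) = if i = j then 1 else 0 := by
    fin_cases i <;> fin_cases j <;> simp [haa, hab, hba, hbb]
  refine ⟨basisOfLinearIndependentOfCardEqFinrank (h.linearIndependent_of_hermForm hx hunitary)
    (by simp [hE]), fun i j => ?_, by simp⟩
  rw [coe_basisOfLinearIndependentOfCardEqFinrank]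
  exact hunitary i j

end IsKahlerOn

variable [FiniteDimensional ℝ E]

theorem IsMetricOn.ricci_pullback (h : IsMetricOn G U) {φ : E → E} {V : Set E}
    (hφ : IsImmersionOn φ V U) {x : E} (hx : x ∈ V) (v w : E) :
    ricci (pullbackMetric φ G) x v w = ricci G (φ x) (fderiv ℝ φ x v) (fderiv ℝ φ x w) := by
  have hP := h.pullback hφ
  let L : E ≃ₗ[ℝ] E := LinearEquiv.ofInjectiveEndo (fderiv ℝ φ x : E →ₗ[ℝ] E) (hφ.injective x hx)
  rw [h.ricci_eq_trace (hφ.mapsTo hx), hP.ricci_eq_trace hx,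
    ← LinearMap.trace_conj' (ricciOperator (pullbackMetric φ G) x v w) L]
  congr 1
  ext u
  obtain ⟨u, rfl⟩ := L.surjective u
  rw [LinearEquiv.conj_apply_apply, LinearEquiv.symm_apply_apply, hP.ricciOperator_apply hx,
    h.ricciOperator_apply (hφ.mapsTo hx)]
  exact h.fderiv_curvature_pullback hφ hx u v w

/-- The parametrisation of a neighbourhood of `y` by normal coordinates, to second order, where `B`
stands for the Christoffel symbols at `y`. -/
def normalParam (B : E →L[ℝ] E →L[ℝ] E) (y z : E) : E := y + z - (1 / 2 : ℝ) • B z z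

omit [FiniteDimensional ℝ E] in
theorem contDiff_normalParam (B : E →L[ℝ] E →L[ℝ] E) (y : E) : ContDiff ℝ ∞ (normalParam B y) :=
  (contDiff_const.add contDiff_id).sub
    ((B.contDiff.clm_apply (f := fun z => B z) contDiff_id).const_smul _)

omit [FiniteDimensional ℝ E] in
theorem fderiv_normalParam {B : E →L[ℝ] E →L[ℝ] E} (hB : ∀ u v, B u v = B v u) (y : E) :
    fderiv ℝ (normalParam B y) = fun z => ContinuousLinearMap.id ℝ E - B z := by
  ext z w
  have hquad : HasFDerivAt (fun z => B z z)
      (B.precompR E z (.id ℝ E) + B.precompL E (.id ℝ E) z) z :=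
    B.hasFDerivAt_of_bilinear (hasFDerivAt_id z) (hasFDerivAt_id z)
  have hparam : HasFDerivAt (normalParam B y) _ z :=
    ((hasFDerivAt_id z).const_add y).sub (hquad.const_smul (1 / 2 : ℝ))
  rw [hparam.fderiv]
  change w - (1 / 2 : ℝ) • (B z w + B w z) = w - B z w
  rw [hB w z]
  module

theorem isImmersionOn_normalParam (h : IsMetricOn G U) {y : E} (hy : y ∈ U) :
    IsImmersionOn (normalParam (christoffelCLM G y) y)
      (normalParam (christoffelCLM G y) y ⁻¹' U ∩ {z | ‖christoffelCLM G y z‖ < 1}) U where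
  isOpen := (h.isOpen.preimage (contDiff_normalParam _ y).continuous).inter
    (isOpen_lt (christoffelCLM G y).continuous.norm continuous_const)
  smooth := (contDiff_normalParam _ y).contDiffOn
  mapsTo _ hz := hz.1
  injective z hz := by
    rw [fderiv_normalParam (h.christoffelCLM_symm hy), injective_iff_map_eq_zero]
    intro u hu
    have hfixed : u = christoffelCLM G y z u := by simpa [sub_eq_zero] using hu
    by_contra hne
    have hlt : ‖christoffelCLM G y z u‖ < ‖u‖ :=
      ((christoffelCLM G y z).le_opNorm u).trans_lt
        (mul_lt_of_lt_one_left (norm_pos_iff.2 hne) hz.2)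
    rw [← hfixed] at hlt
    exact hlt.false

namespace IsKahlerOn

theorem exists_normal_coordinates (h : IsKahlerOn G U) {y : E} (hy : y ∈ U) :
    ∃ (φ : E → E) (V : Opens E), IsHolomorphicImmersionOn φ V U ∧ 0 ∈ V ∧ φ 0 = y ∧
      (∀ u, fderiv ℝ φ 0 u = u) ∧ christoffelCLM (pullbackMetric φ G) 0 = 0 := by
  have hφ := isImmersionOn_normalParam h.toIsMetricOn hy
  have hfderiv := fderiv_normalParam (h.christoffelCLM_symm hy) y
  set φ := normalParam (christoffelCLM G y) y
  have hφ0 : φ 0 = y := by simp [φ, normalParam]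
  have hid (u : E) : fderiv ℝ φ 0 u = u := by simp [hfderiv]
  have h0 : (0 : E) ∈ φ ⁻¹' U ∩ {z | ‖christoffelCLM G y z‖ < 1} := by simp [hφ0, hy]
  refine ⟨φ, ⟨_, hφ.isOpen⟩, ⟨hφ, fun x _ u => ?_⟩, h0, hφ0, hid, ?_⟩
  · simp only [hfderiv, sub_apply, ContinuousLinearMap.id_apply, h.christoffelCLM_I_right y hy,
      smul_sub]
  · ext u v
    have hfderiv₂ : fderiv ℝ (fderiv ℝ φ) 0 u v = -christoffelCLM G y u v := by
      rw [hfderiv, fderiv_const_sub, (christoffelCLM G y).fderiv]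
      rfl
    simpa [hφ0, hid, hfderiv₂] using h.fderiv_christoffel_pullback hφ h0 u v

theorem apply_curvature_pullback (h : IsKahlerOn G U) {φ : E → E} {V : Set E}
    (hφ : IsHolomorphicImmersionOn φ V U) {x : E} (hx : x ∈ V) (u : E) :
    pullbackMetric φ G x (curvature (pullbackMetric φ G) x u (I • u) (I • u)) u =
      G (φ x) (curvature G (φ x) (fderiv ℝ φ x u) (I • fderiv ℝ φ x u) (I • fderiv ℝ φ x u))
        (fderiv ℝ φ x u) := by
  rw [pullbackMetric_apply, h.fderiv_curvature_pullback hφ.toIsImmersionOn hx, hφ.fderiv_I x hx]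

theorem apply_curvature_smul (h : IsKahlerOn G U) {x : E} (hx : x ∈ U) (r : ℝ) (u : E) :
    G x (curvature G x (r • u) (I • r • u) (I • r • u)) (r • u) =
      r ^ 4 * G x (curvature G x u (I • u) (I • u)) u := by
  rw [h.curvature_eq hx, h.curvature_eq hx, smul_comm I r]
  simp only [map_smul, smul_apply, ← smul_add, ← smul_sub, smul_eq_mul]
  ring

theorem nonneg_of_isMin_of_pinched (h : IsKahlerOn G U) (hE : Module.finrank ℂ E = 2)
    (hric : ∀ y ∈ U, ∀ v w, ricci G y v w = 0) {m c : ℝ} (hc : c < (1 + √3) / 2)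
    (hmin : ∀ y ∈ U, ∀ u, m * G y u u ^ 2 ≤ G y (curvature G y u (I • u) (I • u)) u)
    {x : E} (hx : x ∈ U) {u : E} (hu : u ≠ 0)
    (heq : G x (curvature G x u (I • u) (I • u)) u = m * G x u u ^ 2)
    (hmax : ∀ v, G x (curvature G x v (I • v) (I • v)) v ≤ -c * m * G x v v ^ 2) : 0 ≤ m := by
  obtain ⟨φ, V, hφ, h0, rfl, hid, hΓ⟩ := h.exists_normal_coordinates hx
  have hP := h.pullback hφ
  obtain ⟨e, he, he0⟩ := hP.exists_isUnitaryAt hE h0 hu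
  have hform (v : E) :
      pullbackMetric φ G 0 (curvature (pullbackMetric φ G) 0 v (I • v) (I • v)) v =
        G (φ 0) (curvature G (φ 0) v (I • v) (I • v)) v := by
    rw [h.apply_curvature_pullback hφ h0, hid]
  have hmetric (v : E) : pullbackMetric φ G 0 v v = G (φ 0) v v := by
    rw [pullbackMetric_apply, hid]
  have hpos := h.pos _ hx u hu
  refine hP.nonneg_of_isMin (x := ⟨0, h0⟩) hΓ he (fun y hy v w => ?_) hc (fun y hy => ?_) ?_
    fun v => ?_
  · rw [h.ricci_pullback hφ.toIsImmersionOn hy, hric _ (hφ.mapsTo hy)]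
  · rw [h.apply_curvature_pullback hφ hy, pullbackMetric_apply]
    exact hmin _ (hφ.mapsTo hy) _
  · have hsqrt : √(G (φ 0) u u) ^ 4 = G (φ 0) u u ^ 2 := by
      rw [show 4 = 2 * 2 from rfl, pow_mul, Real.sq_sqrt hpos.le]
    rw [he0, hP.apply_curvature_smul h0, hform, heq, hmetric, inv_pow, hsqrt]
    field_simp
  · rw [hform, hmetric]
    exact hmax v

theorem curvature_eq_zero_of_ricci_eq_zero (h : IsKahlerOn G U) (hE : Module.finrank ℂ E = 2)
    {x : E} (hx : x ∈ U) (hric : ∀ v w, ricci G x v w = 0)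
    (hnonneg : ∀ u, 0 ≤ G x (curvature G x u (I • u) (I • u)) u) (u v w : E) :
    curvature G x u v w = 0 := by
  obtain ⟨φ, V, hφ, h0, rfl, hid, hΓ⟩ := h.exists_normal_coordinates hx
  have hP := h.pullback hφ
  have : Nontrivial E := Module.nontrivial_of_finrank_pos (R := ℂ) (by rw [hE]; exact two_pos)
  obtain ⟨a, ha⟩ := exists_ne (0 : E)
  obtain ⟨e, he, -⟩ := hP.exists_isUnitaryAt hE h0 ha
  have hflat : curvature (pullbackMetric φ G) 0 u v w = 0 := by
    refine hP.curvature_eq_zero_of_nonneg (x := ⟨0, h0⟩) hΓ he (fun v w => ?_) (fun u => ?_) u v w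
    · rw [h.ricci_pullback hφ.toIsImmersionOn h0, hric]
    · rw [h.apply_curvature_pullback hφ h0, hid]
      exact hnonneg u
  have hcurv := h.fderiv_curvature_pullback hφ.toIsImmersionOn h0 u v w
  rwa [hflat, map_zero, hid, hid, hid, eq_comm] at hcurv

end IsKahlerOn

end NormalCoordinates

/-! ### The metric in holomorphic charts -/

section Congr

variable {E : Type*} [NormedAddCommGroup E] [NormedSpace ℝ E]
  {G G' : E → E →L[ℝ] E →L[ℝ] ℝ} {U : Set E}

theorem curvature_congr (hU : IsOpen U) (h : Set.EqOn G G' U) {x : E} (hx : x ∈ U) (u v w : E) :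
    curvature G x u v w = curvature G' x u v w := by
  have hΓ (a b : E) : Set.EqOn (christoffel G · a b) (christoffel G' · a b) U := fun y hy => by
    simp only [christoffel, christoffelForm, h hy, fderiv_eq_of_eqOn hU h hy]
  have hΓx (a b : E) : christoffel G x a b = christoffel G' x a b := hΓ a b hx
  rw [curvature, curvature, fderiv_eq_of_eqOn hU (hΓ v w) hx, fderiv_eq_of_eqOn hU (hΓ u w) hx]
  simp only [hΓx]

theorem ricci_congr [FiniteDimensional ℝ E] (hU : IsOpen U) (h : Set.EqOn G G' U) {x : E}
    (hx : x ∈ U) (v w : E) : ricci G x v w = ricci G' x v w := by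
  simp only [ricci, curvature_congr hU h hx]

end Congr

section Charts

open Complex

variable {E : Type*} [NormedAddCommGroup E] [NormedSpace ℂ E]
  {M : Type*} [TopologicalSpace M] [ChartedSpace E M] [IsManifold 𝓘(ℂ, E) ω M]
  {e e' : OpenPartialHomeomorph M E}

theorem mem_source_symm_trans {X Y : Type*} [TopologicalSpace X] [TopologicalSpace Y]
    {e e' : OpenPartialHomeomorph X Y} {y : Y} :
    y ∈ (e.symm.trans e').source ↔ y ∈ e.target ∧ e.symm y ∈ e'.source := by
  rw [OpenPartialHomeomorph.trans_source, e.symm_source, Set.mem_inter_iff, Set.mem_preimage]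

theorem contMDiffOn_mfderiv_symm (he : e ∈ atlas E M) (u : E) :
    ContMDiffOn 𝓘(ℝ, E) (𝓘(ℝ, E).prod 𝓘(ℝ, E)) ∞
      (fun y => (Bundle.TotalSpace.mk' E (e.symm y) (mfderiv 𝓘(ℝ, E) 𝓘(ℝ, E) e.symm y u) :
        TangentBundle 𝓘(ℝ, E) M)) e.target := by
  have hsymm : ContMDiffOn 𝓘(ℝ, E) 𝓘(ℝ, E) ω e.symm e.target :=
    contMDiffOn_symm_of_mem_maximalAtlas (IsManifold.subset_maximalAtlas he)
  have hconst : ContMDiff 𝓘(ℝ, E) (𝓘(ℝ, E).prod 𝓘(ℝ, E)) ∞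
      (fun y : E => (Bundle.TotalSpace.mk' E y u : TangentBundle 𝓘(ℝ, E) E)) :=
    contMDiff_vectorSpace_iff_contDiff.2 contDiff_const
  have htangent := (hsymm.contMDiffOn_tangentMapWithin (m := ∞) (by simp)
    e.open_target.uniqueMDiffOn).comp (hconst.contMDiffOn (s := e.target)) fun y hy => hy
  refine htangent.congr fun y hy => ?_
  simp only [Function.comp, tangentMapWithin, mfderivWithin_of_isOpen e.open_target hy]

theorem contDiffOn_localMetric_apply (g : SmoothMetric E M) (he : e ∈ atlas E M) (u v : E) :
    ContDiffOn ℝ ∞ (fun y => localMetric g e y u v) e.target := by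
  have hsymm : ContMDiffOn 𝓘(ℝ, E) 𝓘(ℝ, E) ∞ e.symm e.target :=
    contMDiffOn_symm_of_mem_maximalAtlas (IsManifold.subset_maximalAtlas he)
  have hbundle : ContMDiffOn 𝓘(ℝ, E) (𝓘(ℝ, E).prod 𝓘(ℝ)) ∞
      (fun y => Bundle.TotalSpace.mk' ℝ (E := Bundle.Trivial M ℝ) (e.symm y)
        (g.inner (e.symm y) (mfderiv 𝓘(ℝ, E) 𝓘(ℝ, E) e.symm y u)
          (mfderiv 𝓘(ℝ, E) 𝓘(ℝ, E) e.symm y v))) e.target :=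
    ContMDiffOn.clm_bundle_apply₂ (F₁ := E) (F₂ := E) (g.contMDiff.comp_contMDiffOn hsymm)
      (contMDiffOn_mfderiv_symm he u) (contMDiffOn_mfderiv_symm he v)
  intro y hy
  have hy' := hbundle y hy
  rw [Bundle.contMDiffWithinAt_totalSpace] at hy'
  exact hy'.2.contDiffWithinAt

theorem isHolomorphicImmersionOn_chart_change (he : e ∈ atlas E M) (he' : e' ∈ atlas E M) :
    IsHolomorphicImmersionOn (e' ∘ e.symm) (e.symm.trans e').source e'.target := by
  have hcompat := HasGroupoid.compatible (G := contDiffGroupoid ω 𝓘(ℂ, E)) he he'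
  rw [contDiffGroupoid, mem_groupoid_of_pregroupoid] at hcompat
  have hsmooth : ContDiffOn ℂ ω (e' ∘ e.symm) (e.symm.trans e').source := by
    simpa [contDiffPregroupoid] using hcompat.1
  have hV := (e.symm.trans e').open_source
  have hmdiff := (mdifferentiable_of_mem_atlas (I := 𝓘(ℝ, E)) he).symm.trans
    (mdifferentiable_of_mem_atlas (I := 𝓘(ℝ, E)) he')
  refine ⟨⟨hV, (hsmooth.restrict_scalars ℝ).of_le (by simp), fun y hy =>
    e'.map_source (mem_source_symm_trans.1 hy).2, fun y hy => ?_⟩, fun y hy u => ?_⟩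
  · rw [← mfderiv_eq_fderiv]
    exact hmdiff.mfderiv_injective hy
  · have hdiff : DifferentiableAt ℂ (e' ∘ e.symm) y :=
      (hsmooth.contDiffAt (hV.mem_nhds hy)).differentiableAt (by simp)
    rw [hdiff.fderiv_restrictScalars ℝ]
    exact map_smul (fderiv ℂ (e' ∘ e.symm) y) I u

theorem mfderiv_symm_eq_comp (he : e ∈ atlas E M) (he' : e' ∈ atlas E M) {y : E}
    (hy : y ∈ (e.symm.trans e').source) (u : E) :
    (mfderiv 𝓘(ℝ, E) 𝓘(ℝ, E) e.symm y u : E) =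
      mfderiv 𝓘(ℝ, E) 𝓘(ℝ, E) e'.symm (e' (e.symm y)) (fderiv ℝ (e' ∘ e.symm) y u) := by
  obtain ⟨hye, hye'⟩ := mem_source_symm_trans.1 hy
  have hd := mdifferentiable_of_mem_atlas (I := 𝓘(ℝ, E)) he
  have hd' := mdifferentiable_of_mem_atlas (I := 𝓘(ℝ, E)) he'
  have heq : e.symm =ᶠ[𝓝 y] e'.symm ∘ (e' ∘ e.symm) := by
    filter_upwards [(e.symm.trans e').open_source.mem_nhds hy] with z hz
    exact (e'.left_inv (mem_source_symm_trans.1 hz).2).symm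
  have hcomp : mfderiv 𝓘(ℝ, E) 𝓘(ℝ, E) (e'.symm ∘ (e' ∘ e.symm)) y = _ :=
    mfderiv_comp y (hd'.mdifferentiableAt_symm (e'.map_source hye'))
      ((hd'.mdifferentiableAt hye').comp y (hd.mdifferentiableAt_symm hye))
  rw [mfderiv_eq_fderiv] at hcomp
  exact congrArg (fun l : E →L[ℝ] E => l u) (heq.mfderiv_eq.trans hcomp)

theorem localMetric_eq_pullback (g : SmoothMetric E M) (he : e ∈ atlas E M)
    (he' : e' ∈ atlas E M) :
    Set.EqOn (localMetric g e) (pullbackMetric (e' ∘ e.symm) (localMetric g e'))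
      (e.symm.trans e').source := by
  intro y hy
  -- All tangent spaces are `E` by definition, which allows comparing them at equal points.
  let b : M → E →L[ℝ] E →L[ℝ] ℝ := fun p => g.inner p
  have hb : b (e'.symm (e' (e.symm y))) = b (e.symm y) := by
    rw [e'.left_inv (mem_source_symm_trans.1 hy).2]
  ext u v
  calc b (e.symm y) (mfderiv 𝓘(ℝ, E) 𝓘(ℝ, E) e.symm y u) (mfderiv 𝓘(ℝ, E) 𝓘(ℝ, E) e.symm y v)
    _ = b (e.symm y)
          (mfderiv 𝓘(ℝ, E) 𝓘(ℝ, E) e'.symm (e' (e.symm y)) (fderiv ℝ (e' ∘ e.symm) y u))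
          (mfderiv 𝓘(ℝ, E) 𝓘(ℝ, E) e'.symm (e' (e.symm y)) (fderiv ℝ (e' ∘ e.symm) y v)) :=
      congrArg₂ (fun a c => b (e.symm y) a c) (mfderiv_symm_eq_comp he he' hy u)
        (mfderiv_symm_eq_comp he he' hy v)
    _ = pullbackMetric (e' ∘ e.symm) (localMetric g e') y u v :=
      congrArg (fun B : E →L[ℝ] E →L[ℝ] ℝ => B _ _) hb.symm

theorem isMetricOn_localMetric [FiniteDimensional ℝ E] (g : SmoothMetric E M)
    (he : e ∈ atlas E M) : IsMetricOn (localMetric g e) e.target where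
  isOpen := e.open_target
  smooth := contDiffOn_clm_apply.2 fun u => contDiffOn_clm_apply.2 fun v =>
    contDiffOn_localMetric_apply g he u v
  symm y _ u v := by
    rw [localMetric_apply, localMetric_apply]
    exact g.symm _ _ _
  pos y hy u hu := by
    have hinj : Function.Injective (mfderiv 𝓘(ℝ, E) 𝓘(ℝ, E) e.symm y) :=
      (mdifferentiable_of_mem_atlas (I := 𝓘(ℝ, E)) he).symm.mfderiv_injective hy
    rw [localMetric_apply]
    exact g.pos _ _ fun h0 => hu (hinj (h0.trans (map_zero _).symm))

theorem isKahlerOn_localMetric [FiniteDimensional ℝ E] {g : SmoothMetric E M} (hK : IsKahler g)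
    (he : e ∈ atlas E M) : IsKahlerOn (localMetric g e) e.target :=
  (isMetricOn_localMetric g he).isKahlerOn (hK.hermitian e he) (hK.closed e he)

theorem ricci_localMetric_eq_zero [FiniteDimensional ℂ E] {g : SmoothMetric E M}
    (hRic : IsRicciFlat g) (he : e ∈ atlas E M) {y : E} (hy : y ∈ e.target) (v w : E) :
    ricci (localMetric g e) y v w = 0 := by
  have he' := chart_mem_atlas E (e.symm y)
  have hyV := mem_source_symm_trans.2 ⟨hy, mem_chart_source E (e.symm y)⟩
  have hφ := (isHolomorphicImmersionOn_chart_change he he').toIsImmersionOn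
  rw [ricci_congr hφ.isOpen (localMetric_eq_pullback g he he') hyV,
    (isMetricOn_localMetric g he').ricci_pullback hφ hyV]
  exact hRic (e.symm y) _ _

end Charts

/-! ### Holomorphic sectional curvature -/

section HolomorphicSectional

open Complex

variable {E : Type*} [NormedAddCommGroup E] [NormedSpace ℂ E]

/-- The holomorphic sectional curvature, in a chart, of the complex line spanned by `u`. -/
def holSectional (G : E → E →L[ℝ] E →L[ℝ] ℝ) (y u : E) : ℝ := sectional G y u (I • u)

namespace IsKahlerOn

variable {G : E → E →L[ℝ] E →L[ℝ] ℝ} {U : Set E}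

theorem le_holSectional_iff (h : IsKahlerOn G U) {x : E} (hx : x ∈ U) {u : E} (hu : u ≠ 0)
    {m : ℝ} : m ≤ holSectional G x u ↔
      m * G x u u ^ 2 ≤ G x (curvature G x u (I • u) (I • u)) u := by
  rw [holSectional, h.sectional_I hx, le_div_iff₀ (pow_pos (h.pos x hx u hu) 2)]

theorem holSectional_le_iff (h : IsKahlerOn G U) {x : E} (hx : x ∈ U) {u : E} (hu : u ≠ 0)
    {m : ℝ} : holSectional G x u ≤ m ↔
      G x (curvature G x u (I • u) (I • u)) u ≤ m * G x u u ^ 2 := by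
  rw [holSectional, h.sectional_I hx, div_le_iff₀ (pow_pos (h.pos x hx u hu) 2)]

variable [FiniteDimensional ℝ E]

theorem holSectional_smul (h : IsKahlerOn G U) {x : E} (hx : x ∈ U) {r : ℝ} (hr : r ≠ 0)
    (u : E) : holSectional G x (r • u) = holSectional G x u := by
  have hmetric : G x (r • u) (r • u) ^ 2 = r ^ 4 * G x u u ^ 2 := by
    simp only [map_smul, smul_apply, smul_eq_mul]
    ring
  rw [holSectional, holSectional, h.sectional_I hx, h.sectional_I hx, h.apply_curvature_smul hx,
    hmetric, mul_div_mul_left _ _ (pow_ne_zero 4 hr)]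

theorem holSectional_pullback (h : IsKahlerOn G U) {φ : E → E} {V : Set E}
    (hφ : IsHolomorphicImmersionOn φ V U) {x : E} (hx : x ∈ V) (u : E) :
    holSectional (pullbackMetric φ G) x u = holSectional G (φ x) (fderiv ℝ φ x u) := by
  rw [holSectional, holSectional, (h.pullback hφ).sectional_I hx, h.sectional_I (hφ.mapsTo hx),
    h.apply_curvature_pullback hφ hx, pullbackMetric_apply]

theorem continuousOn_curvature_I (h : IsKahlerOn G U) (s : Set E) :
    ContinuousOn (fun z : E × E => curvature G z.1 z.2 (I • z.2) (I • z.2)) (U ×ˢ s) := by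
  have hfst : Set.MapsTo Prod.fst (U ×ˢ s) U := fun _ hz => hz.1
  have hΓ : ContinuousOn (fun z : E × E => christoffelCLM G z.1) (U ×ˢ s) :=
    h.contDiffOn_christoffelCLM.continuousOn.comp continuousOn_fst hfst
  have hDΓ : ContinuousOn (fun z : E × E => fderiv ℝ (christoffelCLM G) z.1) (U ×ˢ s) :=
    (contDiffOn_fderiv_of_isOpen h.isOpen h.contDiffOn_christoffelCLM).continuousOn.comp
      continuousOn_fst hfst
  refine ContinuousOn.congr ?_ fun z hz => h.curvature_eq (hfst hz) _ _ _
  fun_prop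

theorem continuousOn_holSectional (h : IsKahlerOn G U) :
    ContinuousOn (fun z : E × E => holSectional G z.1 z.2) (U ×ˢ {0}ᶜ) := by
  have hG : ContinuousOn (fun z : E × E => G z.1) (U ×ˢ {0}ᶜ) :=
    h.smooth.continuousOn.comp continuousOn_fst fun _ hz => hz.1
  have hcurv := h.continuousOn_curvature_I {0}ᶜ
  exact (((hG.clm_apply hcurv).clm_apply continuousOn_snd).div
    (((hG.clm_apply continuousOn_snd).clm_apply continuousOn_snd).pow 2)
    fun z hz => pow_ne_zero 2 (h.pos z.1 hz.1 z.2 hz.2).ne').congr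
    fun z hz => h.sectional_I hz.1 z.2

theorem isCompact_image_holSectional (h : IsKahlerOn G U) {K : Set E} (hK : IsCompact K)
    (hKU : K ⊆ U) : IsCompact ((fun z : E × E => holSectional G z.1 z.2) '' (K ×ˢ {0}ᶜ)) := by
  have : ProperSpace E := FiniteDimensional.proper ℝ E
  have hsphere : Metric.sphere (0 : E) 1 ⊆ {0}ᶜ := fun u hu => ne_zero_of_mem_unit_sphere ⟨u, hu⟩
  have himage : (fun z : E × E => holSectional G z.1 z.2) '' (K ×ˢ {0}ᶜ) =
      (fun z : E × E => holSectional G z.1 z.2) '' (K ×ˢ Metric.sphere 0 1) := by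
    refine (Set.image_mono (Set.prod_mono_right hsphere)).antisymm' ?_
    rintro _ ⟨⟨y, u⟩, ⟨hy, hu⟩, rfl⟩
    have hnorm : ‖u‖ ≠ 0 := norm_ne_zero_iff.2 hu
    refine ⟨(y, ‖u‖⁻¹ • u), ⟨hy, ?_⟩, h.holSectional_smul (hKU hy) (inv_ne_zero hnorm) u⟩
    rw [mem_sphere_zero_iff_norm, norm_smul, norm_inv, norm_norm, inv_mul_cancel₀ hnorm]
  rw [himage]
  exact (hK.prod (isCompact_sphere 0 1)).image_of_continuousOn
    (h.continuousOn_holSectional.mono (Set.prod_mono hKU hsphere))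

end IsKahlerOn

variable [FiniteDimensional ℝ E]
  {M : Type*} [TopologicalSpace M] [ChartedSpace E M] [IsManifold 𝓘(ℂ, E) ω M]
  {g : SmoothMetric E M} {e : OpenPartialHomeomorph M E}

theorem exists_holSectionalAt_symm_iff (hK : IsKahler g) (he : e ∈ atlas E M) {y : E}
    (hy : y ∈ e.target) {k : ℝ} : (∃ u : E, u ≠ 0 ∧ holSectionalAt g (e.symm y) u = k) ↔
      ∃ u : E, u ≠ 0 ∧ holSectional (localMetric g e) y u = k := by
  have he' := chart_mem_atlas E (e.symm y)
  have hyV := mem_source_symm_trans.2 ⟨hy, mem_chart_source E (e.symm y)⟩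
  have hφ := isHolomorphicImmersionOn_chart_change he he'
  set φ := chartAt E (e.symm y) ∘ e.symm
  have hchange (u : E) : holSectional (localMetric g e) y u =
      holSectionalAt g (e.symm y) (fderiv ℝ φ y u) := by
    have heq := localMetric_eq_pullback g he he'
    rw [holSectional, sectional, curvature_congr hφ.isOpen heq hyV, heq hyV]
    exact (isKahlerOn_localMetric hK he').holSectional_pullback hφ hyV u
  have hne {u : E} : fderiv ℝ φ y u ≠ 0 ↔ u ≠ 0 :=
    map_ne_zero_iff (fderiv ℝ φ y) (hφ.injective y hyV)
  rw [(hφ.surjective hyV).exists]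
  simp only [hne, hchange]

theorem exists_mem_nhds_forall_holSectionalAt_le [Nontrivial E] (hK : IsKahler g) (p : M) :
    ∃ N ∈ 𝓝 p, ∃ (q : M) (v : E), v ≠ 0 ∧
      ∀ q' ∈ N, ∀ v' : E, v' ≠ 0 → holSectionalAt g q v ≤ holSectionalAt g q' v' := by
  set e := chartAt E p
  have he : e ∈ atlas E M := chart_mem_atlas E p
  have hp : p ∈ e.source := mem_chart_source E p
  have : ProperSpace E := FiniteDimensional.proper ℝ E
  obtain ⟨K, hKp, hKsub, hKcomp⟩ := local_compact_nhds (e.open_target.mem_nhds (e.map_source hp))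
  obtain ⟨u₀, hu₀⟩ := exists_ne (0 : E)
  obtain ⟨k, ⟨⟨y, u⟩, ⟨hy, hu⟩, hyu⟩, hmin⟩ :=
    ((isKahlerOn_localMetric hK he).isCompact_image_holSectional hKcomp hKsub).exists_isLeast
      (Set.Nonempty.image _ ⟨(e p, u₀), mem_of_mem_nhds hKp, hu₀⟩)
  obtain ⟨v, hv, hvk⟩ := (exists_holSectionalAt_symm_iff hK he (hKsub hy)).2 ⟨u, hu, hyu⟩
  refine ⟨e.source ∩ e ⁻¹' K, Filter.inter_mem (e.open_source.mem_nhds hp)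
    (e.continuousAt hp hKp), e.symm y, v, hv, fun q' hq' v' hv' => ?_⟩
  obtain ⟨w, hw, hwk⟩ := (exists_holSectionalAt_symm_iff hK he (e.map_source hq'.1)).1
    ⟨v', hv', rfl⟩
  rw [hvk, ← e.left_inv hq'.1, ← hwk]
  exact hmin ⟨(e q', w), ⟨hq'.2, hw⟩, rfl⟩

theorem exists_forall_holSectionalAt_le [Nontrivial E] [CompactSpace M] [Nonempty M]
    (hK : IsKahler g) : ∃ (q : M) (v : E), v ≠ 0 ∧
      ∀ (p : M) (u : E), u ≠ 0 → holSectionalAt g q v ≤ holSectionalAt g p u := by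
  choose N hN q v hv hmin using exists_mem_nhds_forall_holSectionalAt_le (E := E) hK
  obtain ⟨t, -, ht⟩ := isCompact_univ.elim_nhds_subcover N fun p _ => hN p
  have hcover (p : M) : ∃ i ∈ t, p ∈ N i := by simpa using ht (Set.mem_univ p)
  have ht_nonempty : t.Nonempty := (hcover (Classical.arbitrary M)).imp fun _ hi => hi.1
  obtain ⟨i, -, hi⟩ := t.exists_min_image (fun p => holSectionalAt g (q p) (v p)) ht_nonempty
  refine ⟨q i, v i, hv i, fun p u hu => ?_⟩
  obtain ⟨j, hj, hp⟩ := hcover p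
  exact (hi j hj).trans (hmin j p hp u hu)

theorem holSectionalAt_le_Hmax (hK : IsKahler g) (p : M) {u : E} (hu : u ≠ 0) :
    holSectionalAt g p u ≤ Hmax g p := by
  have hp : chartAt E p p ∈ (chartAt E p).target := mem_chart_target E p
  obtain ⟨C, hC⟩ := ((isKahlerOn_localMetric hK (chart_mem_atlas E p)).isCompact_image_holSectional
    isCompact_singleton (Set.singleton_subset_iff.2 hp)).bddAbove
  refine le_csSup ⟨C, ?_⟩ ⟨u, hu, rfl⟩
  rintro _ ⟨v, hv, rfl⟩
  exact hC ⟨(_, v), ⟨rfl, hv⟩, rfl⟩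

omit [FiniteDimensional ℝ E] in
theorem Hmin_eq_of_forall_le {p : M} {v : E} (hv : v ≠ 0)
    (hmin : ∀ u : E, u ≠ 0 → holSectionalAt g p v ≤ holSectionalAt g p u) :
    Hmin g p = holSectionalAt g p v :=
  IsLeast.csInf_eq ⟨⟨v, hv, rfl⟩, by rintro _ ⟨u, hu, rfl⟩; exact hmin u hu⟩

end HolomorphicSectional

section RicciFlat

variable {E : Type*} [NormedAddCommGroup E] [NormedSpace ℂ E] [FiniteDimensional ℂ E]
  {M : Type*} [TopologicalSpace M] [ChartedSpace E M] [IsManifold 𝓘(ℂ, E) ω M]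
  {g : SmoothMetric E M}

theorem holSectionalAt_nonneg_of_isMin (hE : Module.finrank ℂ E = 2) (hK : IsKahler g)
    (hRic : IsRicciFlat g) {q : M} {v : E} (hv : v ≠ 0)
    (hmin : ∀ (p : M) (u : E), u ≠ 0 → holSectionalAt g q v ≤ holSectionalAt g p u) {c : ℝ}
    (hc : c < (1 + √3) / 2) (hpinch : Hmax g q ≤ -c * Hmin g q) : 0 ≤ holSectionalAt g q v := by
  have he : chartAt E q ∈ atlas E M := chart_mem_atlas E q
  have hq : chartAt E q q ∈ (chartAt E q).target := mem_chart_target E q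
  have h := isKahlerOn_localMetric hK he
  refine h.nonneg_of_isMin_of_pinched hE (fun y hy => ricci_localMetric_eq_zero hRic he hy) hc
    (fun y hy u => ?_) hq hv (le_antisymm ((h.holSectional_le_iff hq hv).1 le_rfl)
      ((h.le_holSectional_iff hq hv).1 le_rfl)) fun u => ?_
  · rcases eq_or_ne u 0 with rfl | hu
    · simp
    obtain ⟨w, hw, hwu⟩ := (exists_holSectionalAt_symm_iff hK he hy).2 ⟨u, hu, rfl⟩
    exact (h.le_holSectional_iff hy hu).1 ((hmin _ w hw).trans_eq hwu)
  · rcases eq_or_ne u 0 with rfl | hu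
    · simp
    rw [Hmin_eq_of_forall_le hv (hmin q)] at hpinch
    exact (h.holSectional_le_iff hq hu).1 ((holSectionalAt_le_Hmax hK q hu).trans hpinch)

theorem isFlat_of_holSectionalAt_nonneg (hE : Module.finrank ℂ E = 2) (hK : IsKahler g)
    (hRic : IsRicciFlat g) (hnonneg : ∀ (p : M) (u : E), u ≠ 0 → 0 ≤ holSectionalAt g p u) :
    IsFlat g := by
  intro p
  have hp : chartAt E p p ∈ (chartAt E p).target := mem_chart_target E p
  have h := isKahlerOn_localMetric hK (chart_mem_atlas E p)
  refine h.curvature_eq_zero_of_ricci_eq_zero hE hp (hRic p) fun u => ?_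
  rcases eq_or_ne u 0 with rfl | hu
  · simp
  simpa only [zero_mul] using (h.le_holSectional_iff hp hu).1 (hnonneg p u hu)

end RicciFlat

end

theorem theorem1p2_general {E : Type*} [NormedAddCommGroup E] [NormedSpace ℂ E]
    [FiniteDimensional ℂ E] (hE : Module.finrank ℂ E = 2) {M : Type*} [TopologicalSpace M]
    [CompactSpace M] [ChartedSpace E M] [IsManifold 𝓘(ℂ, E) ω M] (g : SmoothMetric E M)
    (hK : IsKahler g) (hRic : IsRicciFlat g)
    (hpinch : ∀ p : M, ∃ c < (1 + √3) / 2, Hmax g p ≤ -c * Hmin g p) : IsFlat g := by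
  refine isFlat_of_holSectionalAt_nonneg hE hK hRic fun p u hu => ?_
  have : Nonempty M := ⟨p⟩
  have : Nontrivial E := ⟨u, 0, hu⟩
  obtain ⟨q, v, hv, hmin⟩ := exists_forall_holSectionalAt_le hK
  obtain ⟨c, hc, hcq⟩ := hpinch q
  exact (holSectionalAt_nonneg_of_isMin hE hK hRic hv hmin hc hcq).trans (hmin p u hu)

theorem theorem1p2 {E : Type*} [NormedAddCommGroup E] [NormedSpace ℂ E]
    [FiniteDimensional ℂ E] (hE : Module.finrank ℂ E = 2)
    {M : Type*} [TopologicalSpace M] [T2Space M] [CompactSpace M]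
    [ChartedSpace E M] [IsManifold 𝓘(ℂ, E) ω M]
    (g : SmoothMetric E M) (hK : IsKahler g) (hRic : IsRicciFlat g)
    (c : ℝ) (hc0 : 0 ≤ c) (hc : c < (1 + √3) / 2)
    (hpinch : ∀ p : M, Hmax g p ≤ -c * Hmin g p) :
    IsFlat g :=
  theorem1p2_general hE g hK hRic fun p => ⟨c, hc, hpinch p⟩
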